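/- $(n-k)$-Regular List Coloring is the following problem parameterized by $k$: given a finite simple graph $G$ on $n$ vertices, an integer $k\ge 0$, a set $T$ of colors, and for every vertex $v$ a list $L(v)\subseteq T$ of exactly $n-k$ colors, decide whether $G$ has a proper list coloring, i.e. a map $\lambda:V(G)\to T$ with $\lambda(v)\in L(v)$ for every vertex $v$ and $\lambda(u)\ne\lambda(v)$ for every edge $uv$. (The size of an instance $I$ is the length of its encoding, in which $n$, $|T|$ and $k$ are written in unary, $G$ is given by its adjacency matrix, and the lists are given by a $0/1$ matrix indexed by $V(G)\times T$.) Theorem. $(n-k)$-Regular List Coloring admits a polynomial kernel with $\mathcal{O}(k^2)$ vertices and $\mathcal{O}(k^2)$ colors. That is, there are a constant $C$, a polynomial $p$ and a polynomial-time algorithm that transforms every instance $I=(G,k,T,L)$ of the problem into an instance $I'=(G',k',T',L')$ of the same problem such that 1. $G$ has a proper list coloring if and only if $G'$ has one; 2. $|I'|+k'\le p(k)$; 3. $|V(G')|\le C k^2$ and $|T'|\le C k^2$. -/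

import Mathlib

/-! ### Polynomial time: a machine model with an explicit step count

Data are finite binary trees (S-expressions over one atom), programs are first-order
`while`-programs over them.  The cost model is the bit-cost model: every executed instruction is
charged one step plus the full size of the datum it is applied to, so data cannot be shared or
copied for free and the result of a run of `t` steps has size at most `t`.  The functions
computable in polynomial time in this model are those computable in polynomial time by (multi-tape)
Turing machines: a tree is written as a string of parentheses, and each instruction is
carried out by a Turing machine in time polynomial in what it is charged; conversely a tape is
a pair of lists. -/

namespace Machine

/-- Data: binary trees without labels. -/
abbrev Data : Type := BinaryTree Unit

namespace Data

abbrev nil : Data := BinaryTree.nil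

/-- The pair of two data. -/
abbrev cons (a b : Data) : Data := BinaryTree.node () a b

/-- First component of a pair (`nil` on the atom). -/
def head : Data → Data
  | .nil => nil
  | .node _ a _ => a

/-- Second component of a pair (`nil` on the atom). -/
def tail : Data → Data
  | .nil => nil
  | .node _ _ b => b

/-- The size of a datum: the number of its pairs. -/
abbrev size (x : Data) : ℕ := x.numNodes

/-- Lists of data are right-nested pairs ended by the atom. -/
def ofList : List Data → Data
  | [] => nil
  | a :: l => cons a (ofList l)

/-- Natural numbers are written in unary. -/
def ofNat (n : ℕ) : Data := ofList (List.replicate n nil)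

/-- Truth values. -/
def ofBool : Bool → Data
  | false => nil
  | true => cons nil nil

end Data

/-- Programs.  Each one acts on a single datum. -/
inductive Prog : Type
  /-- return the atom -/
  | nil : Prog
  /-- return the input -/
  | id : Prog
  /-- return the first component of the input -/
  | head : Prog
  /-- return the second component of the input -/
  | tail : Prog
  /-- run both programs on the input and return the pair of the results -/
  | pair (p q : Prog) : Prog
  /-- run `p`, then run `q` on its result -/
  | seq (p q : Prog) : Prog
  /-- if `c` returns something other than the atom on the input, run `p`, otherwise `q` -/
  | ite (c p q : Prog) : Prog
  /-- while `c` returns something other than the atom on the current datum, replace that datum by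
  the result of `p` on it -/
  | loop (c p : Prog) : Prog

open Data in
/-- `Runs p x y t`: on input `x`, the program `p` halts with output `y` after `t` steps. -/
inductive Runs : Prog → Data → Data → ℕ → Prop
  | nil (x : Data) : Runs .nil x nil (1 + size x)
  | id (x : Data) : Runs .id x x (1 + size x)
  | head (x : Data) : Runs .head x (head x) (1 + size x)
  | tail (x : Data) : Runs .tail x (tail x) (1 + size x)
  | pair {p q : Prog} {x y z : Data} {s t : ℕ} :
      Runs p x y s → Runs q x z t → Runs (.pair p q) x (cons y z) (1 + size x + s + t)
  | seq {p q : Prog} {x y z : Data} {s t : ℕ} :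
      Runs p x y s → Runs q y z t → Runs (.seq p q) x z (1 + size x + s + t)
  | iteTrue {c p q : Prog} {x b y : Data} {s t : ℕ} :
      Runs c x b s → b ≠ .nil → Runs p x y t → Runs (.ite c p q) x y (1 + size x + s + t)
  | iteFalse {c p q : Prog} {x y : Data} {s t : ℕ} :
      Runs c x .nil s → Runs q x y t → Runs (.ite c p q) x y (1 + size x + s + t)
  | loopStop {c p : Prog} {x : Data} {s : ℕ} :
      Runs c x .nil s → Runs (.loop c p) x x (1 + size x + s)
  | loopStep {c p : Prog} {x b y z : Data} {s t u : ℕ} :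
      Runs c x b s → b ≠ .nil → Runs p x y t → Runs (.loop c p) y z u →
      Runs (.loop c p) x z (1 + size x + s + t + u)

/-- Programs are deterministic: output and running time are determined by the input. -/
theorem Runs.unique {p : Prog} {x y : Data} {t : ℕ} (h : Runs p x y t) :
    ∀ {y' : Data} {t' : ℕ}, Runs p x y' t' → y = y' ∧ t = t' := by
  induction h with
  | nil x => intro y' t' h'; cases h'; exact ⟨rfl, rfl⟩
  | id x => intro y' t' h'; cases h'; exact ⟨rfl, rfl⟩
  | head x => intro y' t' h'; cases h'; exact ⟨rfl, rfl⟩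
  | tail x => intro y' t' h'; cases h'; exact ⟨rfl, rfl⟩
  | pair _ _ ih₁ ih₂ =>
    intro y' t' h'
    cases h' with
    | pair h₁ h₂ =>
      obtain ⟨rfl, rfl⟩ := ih₁ h₁
      obtain ⟨rfl, rfl⟩ := ih₂ h₂
      exact ⟨rfl, rfl⟩
  | seq _ _ ih₁ ih₂ =>
    intro y' t' h'
    cases h' with
    | seq h₁ h₂ =>
      obtain ⟨rfl, rfl⟩ := ih₁ h₁
      obtain ⟨rfl, rfl⟩ := ih₂ h₂
      exact ⟨rfl, rfl⟩
  | iteTrue _ hb _ ih₁ ih₂ =>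
    intro y' t' h'
    cases h' with
    | iteTrue h₁ _ h₂ =>
      obtain ⟨rfl, rfl⟩ := ih₁ h₁
      obtain ⟨rfl, rfl⟩ := ih₂ h₂
      exact ⟨rfl, rfl⟩
    | iteFalse h₁ _ => exact absurd (ih₁ h₁).1 hb
  | iteFalse _ _ ih₁ ih₂ =>
    intro y' t' h'
    cases h' with
    | iteTrue h₁ hb _ => exact absurd (ih₁ h₁).1.symm hb
    | iteFalse h₁ h₂ =>
      obtain ⟨_, rfl⟩ := ih₁ h₁
      obtain ⟨rfl, rfl⟩ := ih₂ h₂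
      exact ⟨rfl, rfl⟩
  | loopStop _ ih =>
    intro y' t' h'
    cases h' with
    | loopStop h₁ =>
      obtain ⟨_, rfl⟩ := ih h₁
      exact ⟨rfl, rfl⟩
    | loopStep h₁ hb _ _ => exact absurd (ih h₁).1.symm hb
  | loopStep _ hb _ _ ih₁ ih₂ ih₃ =>
    intro y' t' h'
    cases h' with
    | loopStop h₁ => exact absurd (ih₁ h₁).1 hb
    | loopStep h₁ _ h₂ h₃ =>
      obtain ⟨rfl, rfl⟩ := ih₁ h₁
      obtain ⟨rfl, rfl⟩ := ih₂ h₂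
      obtain ⟨rfl, rfl⟩ := ih₃ h₃
      exact ⟨rfl, rfl⟩

/-- A function between two types of objects encoded as data is computable in polynomial time: one
program computes it on all inputs, in time polynomial in the size of the encoded input. -/
def PolyTime {α β : Type} (encα : α → Data) (encβ : β → Data) (f : α → β) : Prop :=
  ∃ (c : Prog) (p : Polynomial ℕ), ∀ a : α, ∃ t : ℕ,
    t ≤ p.eval (Data.size (encα a)) ∧ Runs c (encα a) (encβ (f a)) t

end Machine

/-! ### Parameterized problems and kernels -/

/-- A parameterized problem: instances with their encoding and their parameter, and the set of
positive instances. -/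
structure ParamProblem where
  Inst : Type
  encode : Inst → Machine.Data
  encode_injective : Function.Injective encode
  param : Inst → ℕ
  Yes : Inst → Prop

namespace ParamProblem

/-- The size of an instance. -/
def size (P : ParamProblem) (I : P.Inst) : ℕ := Machine.Data.size (P.encode I)

/-- A safe polynomial-time reduction rule of `P` to itself. -/
def IsReductionRule (P : ParamProblem) (κ : P.Inst → P.Inst) : Prop :=
  Machine.PolyTime P.encode P.encode κ ∧ ∀ I : P.Inst, P.Yes I ↔ P.Yes (κ I)

/-- A polynomial kernel of `P`: a safe polynomial-time reduction rule whose output has size and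
parameter bounded by a polynomial in the parameter of the input. -/
def IsPolynomialKernel (P : ParamProblem) (κ : P.Inst → P.Inst) : Prop :=
  P.IsReductionRule κ ∧
    ∃ p : Polynomial ℕ, ∀ I : P.Inst, P.size (κ I) + P.param (κ I) ≤ p.eval (P.param I)

end ParamProblem

/-! ### `(n - k)`-Regular List Coloring -/

/-- An instance of `(n - k)`-Regular List Coloring: a finite simple graph on the `n` vertices
`0, …, n - 1`, a number `k`, and for every vertex a list of exactly `n - k` colors, the colors
being `0, …, m - 1`. -/
structure RegularListColoring where
  n : ℕ
  m : ℕ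
  k : ℕ
  G : SimpleGraph (Fin n)
  L : Fin n → Finset (Fin m)
  card_add : ∀ v, (L v).card + k = n

namespace RegularListColoring

/-- The graph has a proper coloring in which each vertex gets a color from its list. -/
def HasListColoring (I : RegularListColoring) : Prop :=
  ∃ c : I.G.Coloring (Fin I.m), ∀ v, c v ∈ I.L v

open Machine Data in
open scoped Classical in
/-- The encoding of an instance: `n`, `m` and `k` in unary, the adjacency matrix of the graph, and
the `n × m` incidence matrix of vertices and colors in their lists. -/
noncomputable def encode (I : RegularListColoring) : Data :=
  ofList [ofNat I.n, ofNat I.m, ofNat I.k,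
    ofList (List.ofFn fun u => ofList (List.ofFn fun v => ofBool (decide (I.G.Adj u v)))),
    ofList (List.ofFn fun v => ofList (List.ofFn fun c => ofBool (decide (c ∈ I.L v))))]

theorem ofList_injective : Function.Injective Machine.Data.ofList := by
  intro l
  induction l with
  | nil => intro l' h; cases l' <;> simp_all [Machine.Data.ofList]
  | cons a l ih =>
    intro l' h
    cases l' with
    | nil => simp [Machine.Data.ofList] at h
    | cons b l' =>
      simp only [Machine.Data.ofList, BinaryTree.node.injEq, true_and] at h
      rw [h.1, ih h.2]

theorem ofNat_injective : Function.Injective Machine.Data.ofNat := by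
  intro a b h
  have := congrArg List.length (ofList_injective h)
  simpa using this

theorem ofBool_injective : Function.Injective Machine.Data.ofBool := by
  intro a b h
  cases a <;> cases b <;> simp_all [Machine.Data.ofBool]

theorem encode_injective : Function.Injective encode := by
  rintro ⟨n, m, k, G, L, h⟩ ⟨n', m', k', G', L', h'⟩ e
  have e := ofList_injective e
  simp only [List.cons.injEq, and_true] at e
  obtain ⟨e₁, e₂, e₃, e₄, e₅⟩ := e
  obtain rfl := ofNat_injective e₁
  obtain rfl := ofNat_injective e₂
  obtain rfl := ofNat_injective e₃
  have hG : G = G' := by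
    ext u v
    have := congrFun (List.ofFn_injective (ofList_injective e₄)) u
    have := congrFun (List.ofFn_injective (ofList_injective this)) v
    simpa using ofBool_injective this
  have hL : L = L' := by
    ext v c
    have := congrFun (List.ofFn_injective (ofList_injective e₅)) v
    have := congrFun (List.ofFn_injective (ofList_injective this)) c
    simpa using congrArg (· = true) (ofBool_injective this)
  subst hG hL
  rfl

/-- `(n - k)`-Regular List Coloring, parameterized by `k`. -/
noncomputable def problem : ParamProblem where
  Inst := RegularListColoring
  encode := encode
  encode_injective := encode_injective
  param := k
  Yes := HasListColoring

end RegularListColoring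

/-! Since every list has n - k colors, an uncolorable graph is very rigid. If distinct colors cannot
be chosen for all vertices, Hall's theorem gives a set S whose lists have a union N(S) with |N(S)| <
|S|. One list already has n - k colors, so fewer than k vertices lie outside S. When n ≥ 30k
(smaller instances keep all vertices), much follows. Every high color lies in N(S), so there are
fewer than n high colors. By double counting, N(S) has at most 2(k - 1) low colors
(`card_low_inter_le`), so fewer than k vertices are rich. Finally, fewer than 2k vertices D meet all
non-adjacent pairs of vertices that are not rich (`exists_cover`), since otherwise k disjoint pairs
could each share a color and the saving would allow a coloring.

Hence all but O(k²) vertices are plain, that is, nearly interchangeable: each is joined to all other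
light vertices and sees nearly all high colors and no other color. The reduction deletes the rich
and the heavy vertices, keeps O(k²) high colors, and thins out the plain vertices so that the
difference between the numbers of high colors and plain vertices is preserved.
`exists_reduced_coloring` carries a coloring to the reduced instance; it uses only the numerical
bounds in `Bounded`. For the converse, the graph is assumed uncolorable, which provides S and D, and
a reduced coloring is extended to the light, the heavy and the rich vertices in turn
(`exists_light_coloring`, `exists_coloring_of_light`, `exists_coloring_of_not_rich`), a
contradiction.

The algorithm never looks for S or D. It only counts against thresholds; if the bounds fail, the
graph is colorable by `bounded_and_not_reduced` and the empty instance is a correct answer. The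
reduced lists have unequal lengths, so `pad` adds a universal clique with its own colors to restore
regularity. Running time is handled by closure properties of `PT`, chiefly bounded iteration over
lists (`PT.foldl`). -/

namespace Machine

/-! ### Polynomial-time functions between encoded types -/

/-- A type whose elements are written as data. -/
class Enc (α : Type) where
  enc : α → Data

namespace Enc

instance : Enc Unit := ⟨fun _ => Data.nil⟩
instance : Enc ℕ := ⟨Data.ofNat⟩
instance : Enc Bool := ⟨Data.ofBool⟩
instance {α β : Type} [Enc α] [Enc β] : Enc (α × β) := ⟨fun x => Data.cons (enc x.1) (enc x.2)⟩
instance {α : Type} [Enc α] : Enc (List α) := ⟨fun l => Data.ofList (l.map enc)⟩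

end Enc

open Enc Polynomial

section Closure

variable {α β γ σ : Type} [Enc α] [Enc β] [Enc γ] [Enc σ]

/-- The size of the encoding. -/
def esize (a : α) : ℕ := Data.size (enc a)

/-- Computability in polynomial time with respect to the standard encodings. -/
@[fun_prop]
def PT (f : α → β) : Prop := PolyTime (enc : α → Data) (enc : β → Data) f

/-- Every instruction is charged the size of its argument, so a time bound is also an output bound.
This is what makes polynomial bounds compose. -/
theorem Runs.size_le {p : Prog} {x y : Data} {t : ℕ} (h : Runs p x y t) : Data.size y ≤ t := by
  induction h with
  | nil x => simp [Data.size, BinaryTree.numNodes]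
  | id x => omega
  | head x => cases x <;> simp [Data.head, Data.size, BinaryTree.numNodes]; omega
  | tail x => cases x <;> simp [Data.tail, Data.size, BinaryTree.numNodes]; omega
  | pair _ _ h₁ h₂ => simp only [Data.size, BinaryTree.numNodes] at *; omega
  | seq _ _ _ h₂ => omega
  | iteTrue _ _ _ _ h₂ => omega
  | iteFalse _ _ _ h₂ => omega
  | loopStop _ _ => omega
  | loopStep _ _ _ _ _ _ h₃ => omega

theorem eval_mono (p : ℕ[X]) {a b : ℕ} (h : a ≤ b) : p.eval a ≤ p.eval b := by
  simp only [eval_eq_sum_range]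
  gcongr

theorem PT.esize_le {f : α → β} (hf : PT f) : ∃ p : ℕ[X], ∀ a, esize (f a) ≤ p.eval (esize a) := by
  obtain ⟨c, p, h⟩ := hf
  refine ⟨p, fun a => ?_⟩
  obtain ⟨t, ht, hr⟩ := h a
  exact hr.size_le.trans ht

/-- A program that realizes the same map on data also realizes any function with the same
encodings. -/
theorem PT.of_enc_eq {f : α → β} {γ δ : Type} [Enc γ] [Enc δ] (hf : PT f) (i : γ → α) {g : γ → δ}
    (hi : ∀ c, enc (i c) = enc c) (hg : ∀ c, enc (f (i c)) = enc (g c)) : PT g := by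
  obtain ⟨c, p, h⟩ := hf
  refine ⟨c, p, fun a => ?_⟩
  obtain ⟨t, ht, hr⟩ := h (i a)
  rw [hi, hg] at hr
  rw [hi] at ht
  exact ⟨t, ht, hr⟩

@[fun_prop]
theorem PT.id : PT (fun a : α => a) :=
  ⟨.id, 1 + X, fun a => ⟨_, by simp, .id _⟩⟩

theorem PT.comp {f : β → γ} {g : α → β} (hf : PT f) (hg : PT g) : PT (fun a => f (g a)) := by
  obtain ⟨c, p, h⟩ := hf
  obtain ⟨d, q, h'⟩ := hg
  refine ⟨.seq d c, 1 + X + q + p.comp q, fun a => ?_⟩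
  obtain ⟨s, hs, hr⟩ := h' a
  obtain ⟨t, ht, hr'⟩ := h (g a)
  refine ⟨_, ?_, .seq hr hr'⟩
  have := eval_mono p (hr.size_le.trans hs)
  simp only [eval_add, eval_one, eval_X, eval_comp]
  omega

attribute [fun_prop] PT.comp

@[fun_prop]
theorem PT.pair {f : α → β} {g : α → γ} (hf : PT f) (hg : PT g) : PT (fun a => (f a, g a)) := by
  obtain ⟨c, p, h⟩ := hf
  obtain ⟨d, q, h'⟩ := hg
  refine ⟨.pair c d, 1 + X + p + q, fun a => ?_⟩
  obtain ⟨s, hs, hr⟩ := h a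
  obtain ⟨t, ht, hr'⟩ := h' a
  refine ⟨_, ?_, .pair hr hr'⟩
  simp only [eval_add, eval_one, eval_X]
  omega

@[fun_prop]
theorem PT.fst : PT (fun x : α × β => x.1) :=
  ⟨.head, 1 + X, fun _ => ⟨_, by simp, .head _⟩⟩

@[fun_prop]
theorem PT.snd : PT (fun x : α × β => x.2) :=
  ⟨.tail, 1 + X, fun _ => ⟨_, by simp, .tail _⟩⟩

theorem exists_const_prog (d : Data) :
    ∃ (c : Prog) (p : ℕ[X]), ∀ x, ∃ t, t ≤ p.eval (Data.size x) ∧ Runs c x d t := by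
  induction d with
  | nil => exact ⟨.nil, 1 + X, fun _ => ⟨_, by simp, .nil _⟩⟩
  | node u a b iha ihb =>
    obtain ⟨c, p, h⟩ := iha
    obtain ⟨d, q, h'⟩ := ihb
    refine ⟨.pair c d, 1 + X + p + q, fun x => ?_⟩
    obtain ⟨s, hs, hr⟩ := h x
    obtain ⟨t, ht, hr'⟩ := h' x
    refine ⟨_, ?_, .pair hr hr'⟩
    simp only [eval_add, eval_one, eval_X]
    omega

@[fun_prop]
theorem PT.const (b : β) : PT (fun _ : α => b) := by
  obtain ⟨c, p, h⟩ := exists_const_prog (enc b)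
  exact ⟨c, p, fun a => h (enc a)⟩

theorem PT.ite_data {f g : α → β} {c : α → γ} {b : α → Bool} (hc : PT c)
    (hb : ∀ a, b a = true ↔ enc (c a) ≠ .nil) (hf : PT f) (hg : PT g) :
    PT (fun a => cond (b a) (f a) (g a)) := by
  obtain ⟨cf, p, h⟩ := hf
  obtain ⟨cg, q, h'⟩ := hg
  obtain ⟨cc, r, h''⟩ := hc
  refine ⟨.ite cc cf cg, 1 + X + r + p + q, fun a => ?_⟩
  obtain ⟨s, hs, hr⟩ := h a
  obtain ⟨t, ht, hr'⟩ := h' a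
  obtain ⟨u, hu, hr''⟩ := h'' a
  simp only [eval_add, eval_one, eval_X]
  cases hba : b a with
  | true =>
    exact ⟨1 + Data.size (enc a) + u + s, by omega, .iteTrue hr'' ((hb a).1 hba) hr⟩
  | false =>
    have : enc (c a) = .nil := by
      by_contra hne
      simp [(hb a).2 hne] at hba
    rw [this] at hr''
    exact ⟨1 + Data.size (enc a) + u + t, by omega, .iteFalse hr'' hr'⟩

@[fun_prop]
theorem PT.cond {c : α → Bool} {f g : α → β} (hc : PT c) (hf : PT f) (hg : PT g) :
    PT (fun a => cond (c a) (f a) (g a)) :=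
  hc.ite_data (fun a => by cases c a <;> simp [enc, Data.ofBool]) hf hg

@[fun_prop]
theorem PT.not {c : α → Bool} (hc : PT c) : PT (fun a => !(c a)) := by
  have : PT (fun a => _root_.cond (c a) false true) := by fun_prop
  convert this using 2 with a
  cases c a <;> rfl

@[fun_prop]
theorem PT.and {c d : α → Bool} (hc : PT c) (hd : PT d) : PT (fun a => c a && d a) := by
  have : PT (fun a => _root_.cond (c a) (d a) false) := by fun_prop
  convert this using 2 with a
  cases c a <;> rfl

@[fun_prop]
theorem PT.or {c d : α → Bool} (hc : PT c) (hd : PT d) : PT (fun a => c a || d a) := by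
  have : PT (fun a => _root_.cond (c a) true (d a)) := by fun_prop
  convert this using 2 with a
  cases c a <;> rfl

@[fun_prop]
theorem PT.cons {f : α → β} {g : α → List β} (hf : PT f) (hg : PT g) : PT (fun a => f a :: g a) :=
  (hf.pair hg).of_enc_eq (fun a => a) (fun _ => rfl) (fun _ => rfl)

@[fun_prop]
theorem PT.list_tail {f : α → List β} (hf : PT f) : PT (fun a => (f a).tail) := by
  have : PT (fun l : List β => l.tail) :=
    ⟨.tail, 1 + X, fun l => ⟨1 + Data.size (enc l), by simp, by
      convert Runs.tail (enc l)
      cases l <;> rfl⟩⟩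
  exact this.comp hf

/-! ### Sizes of encodings and iteration over lists -/

theorem esize_pair (a : α) (b : β) : esize (a, b) = esize a + esize b + 1 := rfl

theorem esize_nil : esize ([] : List α) = 0 := rfl

theorem esize_cons (a : α) (l : List α) : esize (a :: l) = esize a + esize l + 1 := rfl

theorem length_le_esize (l : List α) : l.length ≤ esize l := by
  induction l with
  | nil => simp
  | cons a l ih => rw [esize_cons, List.length_cons]; omega

theorem esize_le_of_mem {a : α} {l : List α} (h : a ∈ l) : esize a ≤ esize l := by
  induction l with
  | nil => simp at h
  | cons b l ih =>
    rw [esize_cons]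
    rcases List.mem_cons.1 h with rfl | h
    · omega
    · have := ih h; omega

theorem esize_append (l l' : List α) : esize (l ++ l') = esize l + esize l' := by
  induction l with
  | nil => simp [esize_nil]
  | cons a l ih => simp only [List.cons_append, esize_cons, ih]; omega

/-- Iteration over a list, when the intermediate states have polynomial size. -/
theorem PT.foldl_of_bound {f : α → List β} {g : α → σ} {h : α → σ → β → σ} (hf : PT f) (hg : PT g)
    (hh : PT (fun x : α × σ × β => h x.1 x.2.1 x.2.2))
    (hb : ∃ q : ℕ[X], ∀ a l₁ l₂, f a = l₁ ++ l₂ →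
      esize (l₁.foldl (h a) (g a)) ≤ q.eval (esize a)) :
    PT (fun a => (f a).foldl (h a) (g a)) := by
  obtain ⟨q, hq⟩ := hb
  obtain ⟨pf, hpf⟩ := hf.esize_le
  have hcond : PT (fun x : α × List β × σ => x.2.1) := by fun_prop
  -- A nonempty list and the pair of its head and tail are the same datum. Typing the state with
  -- such a pair avoids a default head; the loop condition ensures that the body only meets nonempty
  -- lists.
  have hbody : PT (fun x : α × (β × List β) × σ => (x.1, x.2.1.2, h x.1 x.2.2 x.2.1.1)) := by
    have := hh.comp (g := fun x : α × (β × List β) × σ => (x.1, x.2.2, x.2.1.1)) (by fun_prop)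
    fun_prop
  obtain ⟨cc, pc, hcc⟩ := hcond
  obtain ⟨cb, pb, hcb⟩ := hbody
  -- A uniform bound N on all intermediate states bounds the cost of each round, and the number of
  -- rounds is the length of the list.
  have key : ∀ (a : α) (N : ℕ) (l : List β) (s : σ),
      (∀ l₁ l₂, l = l₁ ++ l₂ → esize (a, l₂, l₁.foldl (h a) s) ≤ N) →
      ∃ t, t ≤ (l.length + 1) * (1 + N + pc.eval N + pb.eval N) ∧
        Runs (.loop cc cb) (enc (a, l, s)) (enc (a, ([] : List β), l.foldl (h a) s)) t := by
    intro a N l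
    induction l with
    | nil =>
      intro s hs
      obtain ⟨t, ht, hr⟩ := hcc (a, [], s)
      have h0 := hs [] [] rfl
      have := eval_mono pc h0
      simp only [esize, List.foldl_nil] at *
      exact ⟨1 + Data.size (enc (a, ([] : List β), s)) + t, by simp; omega, .loopStop hr⟩
    | cons b l ih =>
      intro s hs
      obtain ⟨t, ht, hr⟩ := hcc (a, b :: l, s)
      obtain ⟨u, hu, hr'⟩ := hcb (a, (b, l), s)
      obtain ⟨v, hv, hr''⟩ := ih (h a s b) (fun l₁ l₂ e => hs (b :: l₁) l₂ (by rw [e]; rfl))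
      have h0 := hs [] (b :: l) rfl
      have h1 := eval_mono pc h0
      have h2 := eval_mono pb h0
      simp only [esize, List.foldl_nil] at *
      refine ⟨1 + Data.size (enc (a, b :: l, s)) + t + u + v, ?_,
        .loopStep hr (by simp [enc, Data.ofList]) hr' hr''⟩
      have hu' : u ≤ pb.eval (Data.size (enc (a, b :: l, s))) := hu
      rw [List.length_cons, add_mul _ 1, one_mul]
      omega
  have hinit : PT (fun a => (a, f a, g a)) := by fun_prop
  obtain ⟨ci, pi, hci⟩ := hinit
  have hfin : PT (fun x : α × List β × σ => x.2.2) := by fun_prop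
  obtain ⟨ce, pe, hce⟩ := hfin
  set N : ℕ[X] := X + (pf + q + 1) + 1
  set T : ℕ[X] := (pf + 1) * (1 + N + pc.comp N + pb.comp N)
  refine ⟨.seq ci (.seq (.loop cc cb) ce), 1 + X + pi + (1 + N + T + pe.comp N), fun a => ?_⟩
  have hN : ∀ l₁ l₂, f a = l₁ ++ l₂ →
      esize (a, l₂, l₁.foldl (h a) (g a)) ≤ N.eval (esize a) := by
    intro l₁ l₂ e
    have h1 := hq a l₁ l₂ e
    have h2 := hpf a
    rw [e, esize_append] at h2
    simp only [esize_pair, N, eval_add, eval_X, eval_one]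
    omega
  obtain ⟨t, ht, hr⟩ := hci a
  obtain ⟨u, hu, hr'⟩ := key a (N.eval (esize a)) (f a) (g a) hN
  obtain ⟨v, hv, hr''⟩ := hce (a, [], (f a).foldl (h a) (g a))
  refine ⟨_, ?_, .seq hr (.seq hr' hr'')⟩
  have h1 := hN [] (f a) rfl
  have h2 := eval_mono pe (hN (f a) [] (by simp))
  have h3 : u ≤ T.eval (esize a) := by
    refine hu.trans ?_
    simp only [T, eval_mul, eval_add, eval_one, eval_comp]
    have := (length_le_esize (f a)).trans (hpf a)
    gcongr
  simp only [eval_add, eval_one, eval_X, eval_comp]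
  simp only [esize, List.foldl_nil] at *
  omega

/-- Iteration over a list, when every step adds only polynomially many nodes to the state. -/
theorem PT.foldl {f : α → List β} {g : α → σ} {h : α → σ → β → σ} (hf : PT f) (hg : PT g)
    (hh : PT (fun x : α × σ × β => h x.1 x.2.1 x.2.2))
    (hb : ∃ q : ℕ[X], ∀ a s b, b ∈ f a → esize (h a s b) ≤ esize s + q.eval (esize a)) :
    PT (fun a => (f a).foldl (h a) (g a)) := by
  obtain ⟨q, hq⟩ := hb
  obtain ⟨pf, hpf⟩ := hf.esize_le
  obtain ⟨pg, hpg⟩ := hg.esize_le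
  refine hf.foldl_of_bound hg hh ⟨pg + pf * q, fun a l₁ l₂ e => ?_⟩
  have key : ∀ (l : List β) (s : σ), (∀ b ∈ l, b ∈ f a) →
      esize (l.foldl (h a) s) ≤ esize s + l.length * q.eval (esize a) := by
    intro l
    induction l with
    | nil => intro s _; simp
    | cons b l ih =>
      intro s hs
      have h1 := ih (h a s b) fun c hc => hs c (by simp [hc])
      have h2 := hq a s b (hs b (by simp))
      rw [List.foldl_cons, List.length_cons, add_mul, one_mul]
      omega
  have h1 := key l₁ (g a) fun b hb => by rw [e]; simp [hb]
  have h2 := hpg a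
  have h3 : l₁.length ≤ pf.eval (esize a) := by
    refine le_trans ?_ ((length_le_esize (f a)).trans (hpf a))
    rw [e]; simp
  have h4 := Nat.mul_le_mul_right (q.eval (esize a)) h3
  simp only [eval_add, eval_mul]
  omega

@[fun_prop]
theorem PT.list_reverse {f : α → List β} (hf : PT f) : PT (fun a => (f a).reverse) := by
  have : PT (fun a => (f a).foldl (fun s b => b :: s) []) := by
    refine PT.foldl hf (by fun_prop) (by fun_prop) ?_
    obtain ⟨p, hp⟩ := hf.esize_le
    refine ⟨p + 1, fun a s b hb => ?_⟩
    have := (esize_le_of_mem hb).trans (hp a)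
    simp only [esize_cons, eval_add, eval_one]
    omega
  convert this using 2 with a
  simp

theorem PT.map {f : α → List β} {g : α → β → γ} (hf : PT f)
    (hg : PT (fun x : α × β => g x.1 x.2)) : PT (fun a => (f a).map (g a)) := by
  have : PT (fun a => ((f a).foldl (fun s b => g a b :: s) []).reverse) := by
    apply PT.list_reverse
    have hg' := hg.comp (g := fun x : α × List γ × β => (x.1, x.2.2)) (by fun_prop)
    refine PT.foldl hf (by fun_prop) (by fun_prop) ?_
    obtain ⟨p, hp⟩ := hf.esize_le
    obtain ⟨q, hq⟩ := hg.esize_le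
    refine ⟨q.comp (X + p + 1) + 1, fun a s b hb => ?_⟩
    have h1 := (esize_le_of_mem hb).trans (hp a)
    have h2 : esize (a, b) ≤ (X + p + 1 : ℕ[X]).eval (esize a) := by
      simp only [esize_pair, eval_add, eval_one, eval_X]; omega
    have h3 := (hq (a, b)).trans (eval_mono q h2)
    simp only [esize_cons, eval_add, eval_one, eval_comp] at *
    omega
  convert this using 2 with a
  have : ∀ (l : List β) (s : List γ), (l.foldl (fun s b => g a b :: s) s) = (l.map (g a)).reverse ++ s := by
    intro l
    induction l with
    | nil => simp
    | cons b l ih => intro s; simp [ih]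
  simp [this]

theorem PT.filter {f : α → List β} {g : α → β → Bool} (hf : PT f)
    (hg : PT (fun x : α × β => g x.1 x.2)) : PT (fun a => (f a).filter (g a)) := by
  have : PT (fun a => ((f a).foldl (fun s b => _root_.cond (g a b) (b :: s) s) []).reverse) := by
    apply PT.list_reverse
    have hg' := hg.comp (g := fun x : α × List β × β => (x.1, x.2.2)) (by fun_prop)
    refine PT.foldl hf (by fun_prop) (by fun_prop) ?_
    obtain ⟨p, hp⟩ := hf.esize_le
    refine ⟨p + 1, fun a s b hb => ?_⟩
    have h1 := (esize_le_of_mem hb).trans (hp a)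
    cases g a b <;> simp only [_root_.cond, esize_cons, eval_add, eval_one] at * <;> omega
  convert this using 2 with a
  have : ∀ (l : List β) (s : List β),
      (l.foldl (fun s b => _root_.cond (g a b) (b :: s) s) s) = (l.filter (g a)).reverse ++ s := by
    intro l
    induction l with
    | nil => simp
    | cons b l ih => intro s; cases h : g a b <;> simp [ih, h]
  simp [this]

/-! ### Unary arithmetic, selections and tables -/

theorem enc_nat (n : ℕ) : enc n = enc (List.replicate n ()) := by
  simp only [enc, Data.ofNat, List.map_replicate]

theorem esize_nat (n : ℕ) : esize n = n := by
  induction n with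
  | zero => rfl
  | succ n ih =>
    have : esize (n + 1) = 0 + esize n + 1 := rfl
    omega

/-- A unary number and a list of units are the same datum, so list programs serve as arithmetic and
counted repetition is a fold. -/
theorem PT.replicate_unit {f : α → ℕ} (hf : PT f) : PT (fun a => List.replicate (f a) ()) :=
  hf.of_enc_eq (fun a => a) (fun _ => rfl) fun _ => enc_nat _

/-- The length of a list in unary. -/
@[fun_prop]
theorem PT.length {f : α → List β} (hf : PT f) : PT (fun a => (f a).length) := by
  have h : PT (fun a => (f a).map fun _ => ()) := hf.map (by fun_prop)
  refine h.of_enc_eq (fun a => a) (fun _ => rfl) fun a => ?_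
  rw [enc_nat, List.map_const']

@[fun_prop]
theorem PT.succ {f : α → ℕ} (hf : PT f) : PT (fun a => f a + 1) := by
  have h : PT (fun a => () :: List.replicate (f a) ()) := by
    have := hf.replicate_unit
    fun_prop
  refine h.of_enc_eq (fun a => a) (fun _ => rfl) fun a => ?_
  rw [enc_nat, List.replicate_succ]

theorem PT.pred {f : α → ℕ} (hf : PT f) : PT (fun a => f a - 1) := by
  have h : PT (fun a => (List.replicate (f a) ()).tail) := by
    have := hf.replicate_unit
    fun_prop
  refine h.of_enc_eq (fun a => a) (fun _ => rfl) fun a => ?_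
  rw [enc_nat, List.tail_replicate]

/-- Iteration a given number of times. -/
theorem PT.iterate {f : α → ℕ} {g : α → σ} {h : α → σ → σ} (hf : PT f) (hg : PT g)
    (hh : PT (fun x : α × σ => h x.1 x.2))
    (hb : ∃ q : ℕ[X], ∀ a s, esize (h a s) ≤ esize s + q.eval (esize a)) :
    PT (fun a => (h a)^[f a] (g a)) := by
  have hh' := hh.comp (g := fun x : α × σ × Unit => (x.1, x.2.1)) (by fun_prop)
  have : PT (fun a => (List.replicate (f a) ()).foldl (fun s _ => h a s) (g a)) := by
    refine PT.foldl hf.replicate_unit hg hh' ?_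
    obtain ⟨q, hq⟩ := hb
    exact ⟨q, fun a s _ _ => hq a s⟩
  convert this using 2 with a
  generalize g a = s
  induction f a generalizing s with
  | zero => rfl
  | succ n ih => simp [List.replicate_succ, ih]

@[fun_prop]
theorem PT.add {f g : α → ℕ} (hf : PT f) (hg : PT g) : PT (fun a => f a + g a) := by
  have : PT (fun a => (fun s => s + 1)^[g a] (f a)) :=
    PT.iterate hg hf (by fun_prop) ⟨1, fun a s => by simp [esize_nat]⟩
  convert this using 2 with a
  induction g a with
  | zero => rfl
  | succ n ih => rw [Function.iterate_succ_apply', ← ih]; rfl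

@[fun_prop]
theorem PT.sub {f g : α → ℕ} (hf : PT f) (hg : PT g) : PT (fun a => f a - g a) := by
  have : PT (fun a => (fun s => s - 1)^[g a] (f a)) :=
    PT.iterate hg hf (PT.pred (by fun_prop)) ⟨1, fun a s => by simp [esize_nat]; omega⟩
  convert this using 2 with a
  induction g a with
  | zero => rfl
  | succ n ih => rw [Function.iterate_succ_apply', ← ih]; rfl

@[fun_prop]
theorem PT.mul {f g : α → ℕ} (hf : PT f) (hg : PT g) : PT (fun a => f a * g a) := by
  have : PT (fun a => (fun s => s + f a)^[g a] 0) := by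
    refine PT.iterate hg (by fun_prop) ?_ ?_
    · have := hf.comp (g := fun x : α × ℕ => x.1) (by fun_prop)
      fun_prop
    · obtain ⟨p, hp⟩ := hf.esize_le
      refine ⟨p, fun a s => ?_⟩
      have := hp a
      simp only [esize_nat] at *
      omega
  convert this using 2 with a
  induction g a with
  | zero => rfl
  | succ n ih => rw [Function.iterate_succ_apply', ← ih]; rfl

/-- Comparison of numbers, as a truth value. -/
def ltB (a b : ℕ) : Bool := decide (a < b)

@[simp] theorem ltB_eq_true {a b : ℕ} : ltB a b = true ↔ a < b := by simp [ltB]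

@[fun_prop]
theorem PT.ltB {f g : α → ℕ} (hf : PT f) (hg : PT g) : PT (fun a => ltB (f a) (g a)) := by
  -- The truncated difference is encoded by the atom exactly when the comparison fails, so it can
  -- serve as the branching condition.
  have h : PT (fun a => g a - f a) := by fun_prop
  have := PT.ite_data (b := fun a => Machine.ltB (f a) (g a)) h (fun a => ?_)
    (PT.const true) (PT.const false)
  · convert this using 2 with a
    cases Machine.ltB (f a) (g a) <;> rfl
  · rw [ltB_eq_true, ← Nat.sub_pos_iff_lt]
    cases g a - f a <;> simp [enc, Data.ofNat, Data.ofList, List.replicate_succ]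

@[fun_prop]
theorem PT.min {f g : α → ℕ} (hf : PT f) (hg : PT g) : PT (fun a => min (f a) (g a)) := by
  have : PT (fun a => f a - (f a - g a)) := by fun_prop
  convert this using 2 with a
  omega

@[fun_prop]
theorem PT.range {f : α → ℕ} (hf : PT f) : PT (fun a => List.range (f a)) := by
  have : PT (fun a => (fun s : List ℕ => (f a - (s.length + 1)) :: s)^[f a] []) := by
    have hf' := hf.comp (g := fun x : α × List ℕ => x.1) (by fun_prop)
    refine PT.iterate hf (by fun_prop) (by fun_prop) ?_
    obtain ⟨p, hp⟩ := hf.esize_le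
    refine ⟨p + 1, fun a s => ?_⟩
    have := hp a
    simp only [esize_cons, esize_nat, eval_add, eval_one] at *
    omega
  convert this using 2 with a
  generalize f a = n
  have key : ∀ i ≤ n, (fun s : List ℕ => (n - (s.length + 1)) :: s)^[i] [] =
      (List.range i).map (fun j => n - i + j) := by
    intro i
    induction i with
    | zero => simp
    | succ i ih =>
      intro hi
      rw [Function.iterate_succ_apply', ih (by omega), List.range_succ_eq_map]
      simp only [List.length_map, List.length_range, List.map_cons, List.map_map, add_zero,
        List.cons.injEq, true_and, List.map_inj_left, Function.comp]
      intro j _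
      omega
  rw [key n le_rfl]
  simp

/-- The machine returns the atom as the head of the atom, so the default value must be encoded by
the atom. -/
theorem PT.headD {f : α → List β} {d : β} (hf : PT f) (hd : enc d = Data.nil) :
    PT (fun a => (f a).headD d) := by
  have : PT (fun l : List β => l.headD d) :=
    ⟨.head, 1 + X, fun l => ⟨1 + Data.size (enc l), by simp, by
      convert Runs.head (enc l)
      cases l
      · exact hd
      · rfl⟩⟩
  exact this.comp hf

theorem PT.getD {f : α → List β} {g : α → ℕ} {d : β} (hf : PT f) (hg : PT g)
    (hd : enc d = Data.nil) : PT (fun a => (f a).getD (g a) d) := by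
  have : PT (fun a => ((fun s : List β => s.tail)^[g a] (f a)).headD d) := by
    refine PT.headD (PT.iterate hg hf (by fun_prop) ⟨0, fun a s => ?_⟩) hd
    cases s with
    | nil => simp
    | cons b s => simp only [List.tail_cons, esize_cons]; omega
  convert this using 2 with a
  generalize f a = l
  induction g a generalizing l with
  | zero => cases l <;> simp
  | succ n ih => rw [Function.iterate_succ_apply, ← ih]; cases l <;> simp

@[fun_prop]
theorem PT.getD_bool {f : α → List Bool} {g : α → ℕ} (hf : PT f) (hg : PT g) :
    PT (fun a => (f a).getD (g a) false) := hf.getD hg rfl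

@[fun_prop]
theorem PT.getD_nat {f : α → List ℕ} {g : α → ℕ} (hf : PT f) (hg : PT g) :
    PT (fun a => (f a).getD (g a) 0) := hf.getD hg rfl

@[fun_prop]
theorem PT.getD_list {f : α → List (List β)} {g : α → ℕ} (hf : PT f) (hg : PT g) :
    PT (fun a => (f a).getD (g a) []) := hf.getD hg rfl

/-- The numbers below `n` that satisfy `p`. -/
def sel (n : ℕ) (p : ℕ → Bool) : List ℕ := (List.range n).filter p

@[fun_prop]
theorem PT.sel {n : α → ℕ} {p : α → ℕ → Bool} (hn : PT n) (hp : PT (fun x : α × ℕ => p x.1 x.2)) :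
    PT (fun a => sel (n a) (p a)) :=
  PT.filter (by fun_prop) hp

/-- The number of numbers below `n` that satisfy `p`. -/
def countN (n : ℕ) (p : ℕ → Bool) : ℕ := (sel n p).length

@[fun_prop]
theorem PT.countN {n : α → ℕ} {p : α → ℕ → Bool} (hn : PT n)
    (hp : PT (fun x : α × ℕ => p x.1 x.2)) : PT (fun a => countN (n a) (p a)) :=
  (PT.sel hn hp).length

/-- Whether some number below `n` satisfies `p`. -/
def anyN (n : ℕ) (p : ℕ → Bool) : Bool := ltB 0 (countN n p)

@[fun_prop]
theorem PT.anyN {n : α → ℕ} {p : α → ℕ → Bool} (hn : PT n)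
    (hp : PT (fun x : α × ℕ => p x.1 x.2)) : PT (fun a => anyN (n a) (p a)) :=
  PT.ltB (PT.const 0) (PT.countN hn hp)

/-- The table of the values of `g` at the numbers below `n`. -/
def tabulate (n : ℕ) (g : ℕ → γ) : List γ := (List.range n).map g

@[fun_prop]
theorem PT.tabulate {n : α → ℕ} {g : α → ℕ → γ} (hn : PT n)
    (hg : PT (fun x : α × ℕ => g x.1 x.2)) : PT (fun a => tabulate (n a) (g a)) :=
  PT.map (by fun_prop) hg

end Closure

end Machine

namespace ListColoring

set_option linter.unusedSectionVars false

open Finset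
open scoped Classical

/-! ### Partial list colorings and choices of distinct colors -/

section Basics

variable {V T : Type*} [DecidableEq V] [DecidableEq T]

/-- `c` is a proper list coloring of the subgraph induced by `s`. -/
def IsColoringOn (G : SimpleGraph V) (L : V → Finset T) (s : Finset V) (c : V → T) : Prop :=
  (∀ v ∈ s, c v ∈ L v) ∧ ∀ u ∈ s, ∀ v ∈ s, G.Adj u v → c u ≠ c v

theorem IsColoringOn.mono {G : SimpleGraph V} {L : V → Finset T} {s t : Finset V} {c : V → T}
    (h : IsColoringOn G L t c) (hst : s ⊆ t) : IsColoringOn G L s c :=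
  ⟨fun v hv => h.1 v (hst hv), fun u hu v hv => h.2 u (hst hu) v (hst hv)⟩

/-- On a clique a proper coloring is injective. -/
theorem IsColoringOn.injOn {G : SimpleGraph V} {L : V → Finset T} {s t : Finset V} {c : V → T}
    (h : IsColoringOn G L t c) (hst : s ⊆ t) (hs : ∀ u ∈ s, ∀ v ∈ s, u ≠ v → G.Adj u v) :
    Set.InjOn c s := by
  intro u hu v hv huv
  by_contra hne
  exact h.2 u (hst hu) v (hst hv) (hs u hu v hv hne) huv

/-- A coloring is extended by giving distinct new colors to further vertices. -/
theorem IsColoringOn.extend {G : SimpleGraph V} {L : V → Finset T} {s t : Finset V} {c f : V → T}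
    (h : IsColoringOn G L s c) (hf : ∀ v ∈ t, f v ∈ L v) (hinj : Set.InjOn f t)
    (hst : ∀ v ∈ t, ∀ u ∈ s, G.Adj u v → c u ≠ f v) :
    IsColoringOn G L (s ∪ t) (fun v => if v ∈ t then f v else c v) := by
  refine ⟨fun v hv => ?_, fun u hu v hv huv => ?_⟩
  · by_cases hvt : v ∈ t
    · simpa [hvt] using hf v hvt
    · simpa [hvt] using h.1 v (by simpa [hvt] using hv)
  · by_cases hut : u ∈ t <;> by_cases hvt : v ∈ t
    · simpa [hut, hvt] using fun e => huv.ne (hinj hut hvt e)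
    · simpa [hut, hvt] using (hst u hut v (by simpa [hvt] using hv) huv.symm).symm
    · simpa [hut, hvt] using hst v hvt u (by simpa [hut] using hu) huv
    · simpa [hut, hvt] using h.2 u (by simpa [hut] using hu) v (by simpa [hvt] using hv) huv

/-- Hall's theorem for a finite set of indices. -/
theorem exists_injOn_of_hall {ι : Type*} [DecidableEq ι] [Nonempty T] (t : Finset ι)
    (O : ι → Finset T) (h : ∀ s ⊆ t, s.card ≤ (s.biUnion O).card) :
    ∃ f : ι → T, Set.InjOn f t ∧ ∀ i ∈ t, f i ∈ O i := by
  have := (Finset.all_card_le_biUnion_card_iff_exists_injective (fun i : t => O i)).1 (by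
    intro s
    have := h (s.map (Function.Embedding.subtype _)) (by
      intro x hx
      simp only [mem_map, Function.Embedding.subtype_apply] at hx
      obtain ⟨y, _, rfl⟩ := hx
      exact y.2)
    rw [card_map] at this
    convert this using 2
    ext x
    simp)
  obtain ⟨f, hf, hfO⟩ := this
  refine ⟨fun i => if hi : i ∈ t then f ⟨i, hi⟩ else Classical.arbitrary T, ?_, ?_⟩
  · intro i hi j hj hij
    have hi' : i ∈ t := hi
    have hj' : j ∈ t := hj
    simp only [hi', hj', dif_pos] at hij
    simpa using hf hij
  · intro i hi
    simp only [hi, dif_pos]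
    exact hfO ⟨i, hi⟩

/-- If every index has as many options as there are indices, distinct options can be chosen. -/
theorem exists_injOn_of_card_le {ι : Type*} [DecidableEq ι] [Nonempty T] (t : Finset ι)
    (O : ι → Finset T) (h : ∀ i ∈ t, t.card ≤ (O i).card) :
    ∃ f : ι → T, Set.InjOn f t ∧ ∀ i ∈ t, f i ∈ O i := by
  refine exists_injOn_of_hall t O fun s hs => ?_
  rcases s.eq_empty_or_nonempty with rfl | ⟨i, hi⟩
  · simp
  · exact (card_le_card hs).trans ((h i (hs hi)).trans (card_le_card (subset_biUnion_of_mem O hi)))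

end Basics

/-! ### The reduced instance, and its coloring from a coloring of the graph -/

section Reduction

variable {V T : Type*} [Fintype V] [Fintype T] [DecidableEq V] [DecidableEq T]
variable (G : SimpleGraph V) (L : V → Finset T) (k : ℕ)

/-- The vertices with a given color in their lists. -/
def vertsOf (c : T) : Finset V := univ.filter fun v => c ∈ L v

/-- The colors in few lists. -/
def lowColors : Finset T := univ.filter fun c => (vertsOf L c).card < 13 * k

/-- The colors in many lists. -/
def highColors : Finset T := univ.filter fun c => ¬ (vertsOf L c).card < 13 * k

/-- The vertices with many low colors in their lists. -/
def rich : Finset V := univ.filter fun v => 3 * k ≤ (L v ∩ lowColors L k).card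

/-- The vertices other than the rich ones that are not adjacent to a given vertex. -/
noncomputable def nonAdj (v : V) : Finset V := univ.filter fun u => u ∉ rich L k ∧ ¬ G.Adj v u

/-- The vertices with many non-neighbors. -/
noncomputable def heavy : Finset V := univ.filter fun v => v ∉ rich L k ∧ 14 * k ≤ (nonAdj G L k v).card

/-- The vertices that survive the deletion of the rich and the heavy ones. -/
noncomputable def light : Finset V := univ.filter fun v => v ∉ rich L k ∧ v ∉ heavy G L k

/-- The light vertices without low colors that are adjacent to all other light vertices. -/
noncomputable def plain : Finset V := univ.filter fun v => v ∈ light G L k ∧ (∀ c ∈ L v, c ∉ lowColors L k) ∧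
  ∀ u ∈ light G L k, u ≠ v → G.Adj v u

/-- The light vertices that are not plain. -/
noncomputable def core : Finset V := univ.filter fun v => v ∈ light G L k ∧ v ∉ plain G L k

/-- The low colors in lists of vertices that are not rich. -/
def keptLow : Finset T := univ.filter fun c => c ∈ lowColors L k ∧ ∃ v, v ∉ rich L k ∧ c ∈ L v

/-- The lists of the reduced instance with high colors `Q₀`. -/
noncomputable def reducedList (Q₀ : Finset T) (v : V) : Finset T :=
  if v ∈ plain G L k then Q₀ else L v ∩ (keptLow L k ∪ Q₀)

variable {G L k}

theorem mem_highColors {c : T} : c ∈ highColors L k ↔ c ∉ lowColors L k := by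
  simp [highColors, lowColors]

theorem mem_light {v : V} : v ∈ light G L k ↔ v ∉ rich L k ∧ v ∉ heavy G L k := by simp [light]

theorem mem_core {v : V} : v ∈ core G L k ↔ v ∈ light G L k ∧ v ∉ plain G L k := by simp [core]

theorem mem_plain {v : V} : v ∈ plain G L k ↔ v ∈ light G L k ∧ (∀ c ∈ L v, c ∉ lowColors L k) ∧
    ∀ u ∈ light G L k, u ≠ v → G.Adj v u := by simp [plain]

theorem mem_nonAdj {u v : V} : u ∈ nonAdj G L k v ↔ u ∉ rich L k ∧ ¬ G.Adj v u := by simp [nonAdj]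

theorem mem_keptLow {c : T} :
    c ∈ keptLow L k ↔ c ∈ lowColors L k ∧ ∃ v, v ∉ rich L k ∧ c ∈ L v := by simp [keptLow]

theorem card_nonAdj_lt {v : V} (hv : v ∈ light G L k) : (nonAdj G L k v).card < 14 * k := by
  rw [mem_light] at hv
  by_contra h
  exact hv.2 (by simp [heavy, hv.1]; omega)

theorem card_inter_low_lt {v : V} (hv : v ∉ rich L k) : (L v ∩ lowColors L k).card < 3 * k := by
  simpa [rich] using hv

theorem card_inter_high_add (v : V) :
    (L v ∩ highColors L k).card + (L v ∩ lowColors L k).card = (L v).card := by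
  have : L v ∩ highColors L k = L v \ lowColors L k := by
    ext c; simp [mem_highColors]
  rw [this, add_comm, card_inter_add_card_sdiff]

/-- If there are fewer high colors than vertices, a vertex that is not rich misses few of them. -/
theorem card_high_sdiff_le (hL : ∀ v, (L v).card + k = Fintype.card V)
    (hQ : (highColors L k).card < Fintype.card V) {v : V} (hv : v ∉ rich L k) :
    (highColors L k \ L v).card ≤ 4 * k := by
  have h1 := card_inter_low_lt hv
  have h2 := card_inter_high_add (L := L) (k := k) v
  have h3 := hL v
  have h4 := card_sdiff_add_card_inter (highColors L k) (L v)
  rw [inter_comm] at h4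
  omega

/-- A coloring of the graph yields one of the reduced instance. -/
theorem exists_reduced_coloring [Nonempty T] (hL : ∀ v, (L v).card + k = Fintype.card V)
    (hQ : (highColors L k).card < Fintype.card V) (hW : (plain G L k)ᶜ.card ≤ 60 * k ^ 2)
    {Q₀ : Finset T} {W₀ : Finset V} (hQ₀ : Q₀ ⊆ highColors L k) (hW₀ : W₀ ⊆ plain G L k)
    (hcQ : Q₀.card = min (highColors L k).card (120 * k ^ 2))
    (hcW : W₀.card = Q₀.card + (plain G L k).card - (highColors L k).card)
    {c : V → T} (hc : IsColoringOn G L univ c) :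
    ∃ c', IsColoringOn G (reducedList G L k Q₀) (core G L k ∪ W₀) c' := by
  have hWQ : ∀ v ∈ plain G L k, c v ∈ highColors L k := fun v hv =>
    mem_highColors.2 ((mem_plain.1 hv).2.1 _ (hc.1 v (mem_univ v)))
  have hR : ∀ v ∈ core G L k, c v ∉ highColors L k → c v ∈ keptLow L k := fun v hv h =>
    mem_keptLow.2 ⟨by simpa [mem_highColors] using h, v, (mem_light.1 (mem_core.1 hv).1).1,
      hc.1 v (mem_univ v)⟩
  -- If all high colors are kept, the given coloring restricts without change.
  rcases le_total (highColors L k).card (120 * k ^ 2) with hle | hle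
  · rw [min_eq_left hle] at hcQ
    obtain rfl := eq_of_subset_of_card_le hQ₀ hcQ.ge
    refine ⟨c, fun v hv => ?_, fun u _ v _ => hc.2 u (mem_univ u) v (mem_univ v)⟩
    rw [reducedList]
    split_ifs with h
    · exact hWQ v h
    · have hvK : v ∈ core G L k := by
        rcases mem_union.1 hv with h' | h'
        · exact h'
        · exact absurd (hW₀ h') h
      rw [mem_inter, mem_union]
      refine ⟨hc.1 v (mem_univ v), ?_⟩
      by_cases h' : c v ∈ highColors L k
      · exact Or.inr h'
      · exact Or.inl (hR v hvK h')
  · rw [min_eq_right hle] at hcQ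
    have hK : (core G L k).card ≤ 60 * k ^ 2 := (card_le_card fun v hv => by
      simpa using (mem_core.1 hv).2).trans hW
    set Γ := (core G L k).image c ∩ highColors L k with hΓ
    have hΓK : Γ.card ≤ 60 * k ^ 2 :=
      (card_le_card inter_subset_left).trans (card_image_le.trans hK)
    -- The plain vertices form a clique joined to the core, so their colors are distinct, high and
    -- outside Γ.
    have hΓW : Γ.card + (plain G L k).card ≤ (highColors L k).card := by
      have hinj : Set.InjOn c (plain G L k) := hc.injOn (subset_univ _) fun u hu v hv huv =>
        (mem_plain.1 hu).2.2 v (mem_plain.1 hv).1 huv.symm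
      rw [← card_image_of_injOn hinj, ← card_union_of_disjoint]
      · refine card_le_card (union_subset inter_subset_right fun x hx => ?_)
        obtain ⟨v, hv, rfl⟩ := mem_image.1 hx
        exact hWQ v hv
      · rw [Finset.disjoint_left]
        intro x hx hx'
        obtain ⟨u, hu, rfl⟩ := mem_image.1 (mem_inter.1 hx).1
        obtain ⟨v, hv, hvu⟩ := mem_image.1 hx'
        refine hc.2 v (mem_univ v) u (mem_univ u) ((mem_plain.1 hv).2.2 u (mem_core.1 hu).1 ?_) hvu
        rintro rfl
        exact (mem_core.1 hu).2 hv
    -- Each high color class of the core is moved as a whole to a kept color. The class of a core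
    -- vertex u consists of non-neighbors of u, hence fewer than 14k core vertices, each missing at
    -- most 4k high colors. So at most 56k² of the 120k² kept colors are forbidden, and the
    -- remaining 64k² suffice for at most 60k² classes.
    obtain ⟨f, hf, hfO⟩ := exists_injOn_of_card_le Γ
      (fun γ => Q₀.filter fun q => ∀ v ∈ core G L k, c v = γ → q ∈ L v) (by
        intro γ hγ
        obtain ⟨u, hu, hγu⟩ := mem_image.1 (mem_inter.1 hγ).1
        have h1 : (Q₀.filter fun q => ¬ ∀ v ∈ core G L k, c v = γ → q ∈ L v) ⊆
            (nonAdj G L k u ∩ core G L k).biUnion fun v => highColors L k \ L v := by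
          intro q hq
          simp only [mem_filter, not_forall] at hq
          obtain ⟨hq, v, hv, hvγ, hqv⟩ := hq
          refine mem_biUnion.2 ⟨v, mem_inter.2 ⟨mem_nonAdj.2
            ⟨(mem_light.1 (mem_core.1 hv).1).1, fun h => ?_⟩, hv⟩, mem_sdiff.2 ⟨hQ₀ hq, hqv⟩⟩
          exact hc.2 u (mem_univ u) v (mem_univ v) h (hγu.trans hvγ.symm)
        have h2 := (card_le_card h1).trans (card_biUnion_le_card_mul _ _ (4 * k) fun v hv =>
          card_high_sdiff_le hL hQ (mem_light.1 (mem_core.1 (mem_inter.1 hv).2).1).1)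
        have h3 := card_nonAdj_lt (mem_core.1 hu).1
        have h4 := card_le_card (inter_subset_left : nonAdj G L k u ∩ core G L k ⊆ _)
        have h5 := card_filter_add_card_filter_not (s := Q₀)
          (fun q => ∀ v ∈ core G L k, c v = γ → q ∈ L v)
        have h6 := Nat.mul_le_mul_right (4 * k) (h4.trans h3.le)
        have h7 : 14 * k * (4 * k) = 56 * k ^ 2 := by ring
        omega)
    -- By `hΓW` and the choice of |W₀|, at least |W₀| kept colors remain unused by the core.
    obtain ⟨g, hg, hgO⟩ := exists_injOn_of_card_le W₀ (fun _ => Q₀ \ Γ.image f) (by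
      intro v _
      have h1 := le_card_sdiff (Γ.image f) Q₀
      have h2 : (Γ.image f).card ≤ Γ.card := card_image_le
      omega)
    have hcore : IsColoringOn G (reducedList G L k Q₀) (core G L k)
        (fun v => if c v ∈ highColors L k then f (c v) else c v) := by
      have hmem : ∀ v ∈ core G L k, c v ∈ highColors L k → c v ∈ Γ := fun v hv h =>
        mem_inter.2 ⟨mem_image_of_mem c hv, h⟩
      have hfl : ∀ v ∈ core G L k, c v ∈ highColors L k → f (c v) ∈ highColors L k :=
        fun v hv h => hQ₀ (mem_filter.1 (hfO _ (hmem v hv h))).1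
      refine ⟨fun v hv => ?_, fun u hu v hv huv => ?_⟩
      · rw [reducedList, if_neg (mem_core.1 hv).2, mem_inter, mem_union]
        dsimp only
        split_ifs with h
        · have := mem_filter.1 (hfO _ (hmem v hv h))
          exact ⟨this.2 v hv rfl, Or.inr this.1⟩
        · exact ⟨hc.1 v (mem_univ v), Or.inl (hR v hv h)⟩
      · have hne := hc.2 u (mem_univ u) v (mem_univ v) huv
        dsimp only
        split_ifs with h h' h'
        · exact fun e => hne (hf (hmem u hu h) (hmem v hv h') e)
        · exact fun e => h' (e ▸ hfl u hu h)
        · exact fun e => h (e ▸ hfl v hv h')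
        · exact hne
    refine ⟨_, hcore.extend (fun v hv => ?_) hg fun v hv u hu _ => ?_⟩
    · rw [reducedList, if_pos (hW₀ hv)]
      exact (mem_sdiff.1 (hgO v hv)).1
    · have := mem_sdiff.1 (hgO v hv)
      split_ifs with h
      · intro e
        exact this.2 (e ▸ mem_image_of_mem f (mem_inter.2 ⟨mem_image_of_mem c hu, h⟩))
      · intro e
        exact h (e ▸ hQ₀ this.1)

end Reduction

end ListColoring

namespace ListColoring

set_option linter.unusedSectionVars false

open Finset
open scoped Classical

/-! ### Structure forced by a Hall violator -/

section Violator

variable {V T : Type*} [Fintype V] [Fintype T] [DecidableEq V] [DecidableEq T]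
variable {G : SimpleGraph V} {L : V → Finset T} {k : ℕ}

/-- If all vertices can get distinct colors, there is a coloring. -/
theorem exists_coloring_of_hall [Nonempty T] (h : ∀ S : Finset V, S.card ≤ (S.biUnion L).card) :
    ∃ c, IsColoringOn G L univ c := by
  obtain ⟨f, hf, hfL⟩ := exists_injOn_of_hall univ L fun s _ => h s
  exact ⟨f, hfL, fun u hu v hv huv e => huv.ne (hf hu hv e)⟩

variable (hL : ∀ v, (L v).card + k = Fintype.card V) {S : Finset V}
  (hS : (S.biUnion L).card < S.card)

include hL hS

theorem card_le_card_biUnion_add : Fintype.card V ≤ (S.biUnion L).card + k := by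
  have : S.Nonempty := card_pos.1 (by omega)
  obtain ⟨v, hv⟩ := this
  have := card_le_card (subset_biUnion_of_mem L hv)
  have := hL v
  omega

/-- A single list of a vertex of S puts n - k colors into N(S), and S is larger than N(S). -/
theorem card_compl_lt : Sᶜ.card < k := by
  have := card_le_card_biUnion_add hL hS
  have := card_compl_add_card S
  omega

/-- A color outside N(S) occurs only in lists of vertices outside S; there are fewer than k of them,
so the color is low. -/
theorem highColors_subset : highColors L k ⊆ S.biUnion L := by
  intro c hc
  by_contra h
  have h1 : vertsOf L c ⊆ Sᶜ := fun v hv => by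
    rw [mem_compl]
    exact fun hvS => h (mem_biUnion.2 ⟨v, hvS, by simpa [vertsOf] using hv⟩)
  have h2 := card_le_card h1
  have h3 := card_compl_lt hL hS
  simp only [highColors, mem_filter, mem_univ, true_and] at hc
  omega

theorem card_highColors_lt : (highColors L k).card < Fintype.card V :=
  (card_le_card (highColors_subset hL hS)).trans_lt (hS.trans_le (card_le_univ S))

/-- Count pairs of a vertex v of S and a low color of N(S) missing from L(v). A low color is missing
from at least |S| - 13k of these lists, while v misses at most |N(S)| - (n - k) ≤ k - 1 colors of
N(S). -/
theorem card_low_inter_le (hn : 30 * k ≤ Fintype.card V) :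
    (lowColors L k ∩ S.biUnion L).card ≤ 2 * (k - 1) := by
  set N := S.biUnion L
  set X := lowColors L k ∩ N
  have hk := card_compl_lt hL hS
  have hSn := card_compl_add_card S
  have h1 : X.card * (S.card - 13 * k) ≤ S.card * (k - 1) := by
    refine card_mul_le_card_mul' (fun v c => c ∉ L v) (fun c hc => ?_) fun v hv => ?_
    · have hlow := (mem_inter.1 hc).1
      simp only [lowColors, mem_filter, mem_univ, true_and] at hlow
      have : S \ vertsOf L c ⊆ bipartiteBelow (fun v c => c ∉ L v) S c := by
        intro v hv
        simpa [bipartiteBelow, vertsOf] using hv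
      have h' := card_le_card this
      have := le_card_sdiff (vertsOf L c) S
      omega
    · have hvN : L v ⊆ N := subset_biUnion_of_mem L hv
      have : bipartiteAbove (fun v c => c ∉ L v) X v ⊆ N \ L v := by
        intro c hc
        simp only [bipartiteAbove, mem_filter] at hc
        exact mem_sdiff.2 ⟨(mem_inter.1 hc.1).2, hc.2⟩
      have h' := card_le_card this
      rw [card_sdiff_of_subset hvN] at h'
      have := hL v
      omega
  -- Since |S| > n - k ≥ 29k, subtracting 13k loses at most half of |S|.
  have h2 : X.card * S.card ≤ 2 * (k - 1) * S.card := by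
    calc X.card * S.card ≤ X.card * (2 * (S.card - 13 * k)) := by
          gcongr; omega
      _ = 2 * (X.card * (S.card - 13 * k)) := by ring
      _ ≤ 2 * (S.card * (k - 1)) := by gcongr
      _ = 2 * (k - 1) * S.card := by ring
  exact Nat.le_of_mul_le_mul_right h2 (by omega)

/-- A rich vertex in S would bring 3k low colors into N(S), which has at most 2(k - 1). -/
theorem rich_subset (hn : 30 * k ≤ Fintype.card V) : rich L k ⊆ Sᶜ := by
  intro v hv
  rw [mem_compl]
  intro hvS
  have h1 := card_low_inter_le hL hS hn
  have h2 := card_compl_lt hL hS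
  have h3 : L v ∩ lowColors L k ⊆ lowColors L k ∩ S.biUnion L := fun c hc =>
    mem_inter.2 ⟨(mem_inter.1 hc).2, mem_biUnion.2 ⟨v, hvS, (mem_inter.1 hc).1⟩⟩
  have h4 := card_le_card h3
  simp only [rich, mem_filter, mem_univ, true_and] at hv
  omega

theorem card_rich_lt (hn : 30 * k ≤ Fintype.card V) : (rich L k).card < k :=
  (card_le_card (rich_subset hL hS hn)).trans_lt (card_compl_lt hL hS)

/-- A kept low color either lies in N(S) or is one of fewer than 3k low colors of one of fewer than
k vertices outside S. -/
theorem card_keptLow_le (hn : 30 * k ≤ Fintype.card V) : (keptLow L k).card ≤ 6 * k ^ 2 := by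
  have h1 : keptLow L k ⊆ (lowColors L k ∩ S.biUnion L) ∪
      (Sᶜ \ rich L k).biUnion fun v => L v ∩ lowColors L k := by
    intro c hc
    obtain ⟨hc, v, hv, hcv⟩ := mem_keptLow.1 hc
    by_cases hvS : v ∈ S
    · exact mem_union_left _ (mem_inter.2 ⟨hc, mem_biUnion.2 ⟨v, hvS, hcv⟩⟩)
    · exact mem_union_right _ (mem_biUnion.2 ⟨v, by simp [hvS, hv], mem_inter.2 ⟨hcv, hc⟩⟩)
  have h2 := (card_le_card h1).trans (card_union_le _ _)
  have h3 := card_low_inter_le hL hS hn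
  have h4 := card_compl_lt hL hS
  have h5 := card_biUnion_le_card_mul (Sᶜ \ rich L k) (fun v => L v ∩ lowColors L k) (3 * k)
    fun v hv => (card_inter_low_lt (mem_sdiff.1 hv).2).le
  have h6 := card_le_card (sdiff_subset : Sᶜ \ rich L k ⊆ Sᶜ)
  have h7 := Nat.mul_le_mul_right (3 * k) (h6.trans h4.le)
  have h8 : k * (3 * k) = 3 * k ^ 2 := by ring
  have h9 : k ≤ k ^ 2 := Nat.le_self_pow two_ne_zero k
  omega

/-- Few vertices have low colors. -/
theorem card_meets_low_le (hn : 30 * k ≤ Fintype.card V) :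
    (univ.filter fun v => ∃ c ∈ L v, c ∈ lowColors L k).card ≤ k + 26 * k ^ 2 := by
  have h1 : (univ.filter fun v => ∃ c ∈ L v, c ∈ lowColors L k) ⊆
      Sᶜ ∪ (lowColors L k ∩ S.biUnion L).biUnion (vertsOf L) := by
    intro v hv
    simp only [mem_filter, mem_univ, true_and] at hv
    obtain ⟨c, hcv, hc⟩ := hv
    by_cases hvS : v ∈ S
    · exact mem_union_right _ (mem_biUnion.2 ⟨c, mem_inter.2 ⟨hc, mem_biUnion.2 ⟨v, hvS, hcv⟩⟩,
        by simpa [vertsOf] using hcv⟩)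
    · exact mem_union_left _ (by simpa using hvS)
  have h2 := (card_le_card h1).trans (card_union_le _ _)
  have h3 := card_low_inter_le hL hS hn
  have h4 := card_compl_lt hL hS
  have h5 := card_biUnion_le_card_mul (lowColors L k ∩ S.biUnion L) (vertsOf L) (13 * k)
    fun c hc => by
      have := (mem_inter.1 hc).1
      simp only [lowColors, mem_filter, mem_univ, true_and] at this
      exact this.le
  have h6 : (lowColors L k ∩ S.biUnion L).card ≤ 2 * k := by omega
  have h7 := Nat.mul_le_mul_right (13 * k) h6
  have h8 : 2 * k * (13 * k) = 26 * k ^ 2 := by ring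
  omega

omit hS in
/-- Either few vertices cover all pairs of non-adjacent vertices that are not rich, or there is a
coloring in which many pairs of vertices share their colors. -/
theorem exists_cover_or_coloring [Nonempty T] (hn : 30 * k ≤ Fintype.card V)
    (hQ : (highColors L k).card < Fintype.card V) (j : ℕ) (hj : j ≤ k) :
    (∃ D, D ⊆ (rich L k)ᶜ ∧ D.card < 2 * j ∧
      ∀ u ∉ rich L k, u ∉ D → ∀ v ∉ rich L k, v ∉ D → u ≠ v → G.Adj u v) ∨
    ∃ D : Finset V, ∃ c, D ⊆ (rich L k)ᶜ ∧ D.card = 2 * j ∧ IsColoringOn G L D c ∧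
      (D.image c).card ≤ j := by
  induction j with
  | zero => exact Or.inr ⟨∅, fun _ => Classical.arbitrary T, by simp, by simp,
      ⟨by simp, by simp⟩, by simp⟩
  | succ j ih =>
    rcases ih (by omega) with ⟨D, h1, h2, h3⟩ | ⟨D, c, h1, h2, h3, h4⟩
    · exact Or.inl ⟨D, h1, by omega, h3⟩
    by_cases hD : ∀ u ∉ rich L k, u ∉ D → ∀ v ∉ rich L k, v ∉ D → u ≠ v → G.Adj u v
    · exact Or.inl ⟨D, h1, by omega, hD⟩
    push Not at hD
    obtain ⟨u, hu, huD, v, hv, hvD, huv, hadj⟩ := hD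
    -- Both vertices are not rich: u has more than n - 4k high colors and v misses at most 4k of
    -- them. Thus they share more than n - 8k ≥ 22k, and at most j < k are used already.
    have h5 : ((highColors L k ∩ L u ∩ L v) \ D.image c).Nonempty := by
      have e1 := card_high_sdiff_le hL hQ hv
      have e2 := card_inter_low_lt hu
      have e3 := card_inter_high_add (L := L) (k := k) u
      have e4 := hL u
      have e5 : (L u ∩ highColors L k).card ≤
          (highColors L k ∩ L u ∩ L v).card + (highColors L k \ L v).card := by
        rw [← card_inter_add_card_sdiff (L u ∩ highColors L k) (L v), inter_comm (L u)]
        gcongr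
        exact inter_subset_left
      have e6 := le_card_sdiff (D.image c) (highColors L k ∩ L u ∩ L v)
      exact card_pos.1 (by omega)
    obtain ⟨q, hq⟩ := h5
    simp only [mem_sdiff, mem_inter] at hq
    obtain ⟨⟨⟨-, hqu⟩, hqv⟩, hqD⟩ := hq
    have hq' : ∀ x ∈ D, c x ≠ q := fun x hx e => hqD (e ▸ mem_image_of_mem c hx)
    have hu' : ∀ x ∈ D, x ≠ u := fun x hx e => huD (e ▸ hx)
    have hv' : ∀ x ∈ D, x ≠ v := fun x hx e => hvD (e ▸ hx)
    refine Or.inr ⟨insert u (insert v D), fun x => if x = u ∨ x = v then q else c x, ?_, ?_,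
      ⟨?_, ?_⟩, ?_⟩
    · intro x hx
      simp only [mem_insert] at hx
      rcases hx with rfl | rfl | hx
      · simpa using hu
      · simpa using hv
      · exact h1 hx
    · rw [card_insert_of_notMem (by simp [huv, huD]), card_insert_of_notMem hvD]
      omega
    · intro x hx
      simp only [mem_insert] at hx
      rcases hx with rfl | rfl | hx
      · simpa using hqu
      · simpa using hqv
      · simpa [hu' x hx, hv' x hx] using h3.1 x hx
    · have hvu : ¬ G.Adj v u := fun h => hadj h.symm
      intro x hx y hy hxy
      simp only [mem_insert] at hx hy
      rcases hx with rfl | rfl | hx <;> rcases hy with rfl | rfl | hy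
      · exact absurd hxy (G.irrefl)
      · exact absurd hxy hadj
      · simpa [hu' y hy, hv' y hy] using (hq' y hy).symm
      · exact absurd hxy hvu
      · exact absurd hxy (G.irrefl)
      · simpa [hu' y hy, hv' y hy] using (hq' y hy).symm
      · simpa [hu' x hx, hv' x hx] using hq' x hx
      · simpa [hu' x hx, hv' x hx] using hq' x hx
      · simpa [hu' x hx, hv' x hx, hu' y hy, hv' y hy] using h3.2 x hx y hy hxy
    · have : (insert u (insert v D)).image (fun x => if x = u ∨ x = v then q else c x) ⊆
          insert q (D.image c) := by
        intro z hz
        obtain ⟨x, hx, rfl⟩ := mem_image.1 hz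
        split_ifs with h
        · simp
        · simp only [mem_insert] at hx
          exact mem_insert_of_mem (mem_image_of_mem c (by tauto))
      have := (card_le_card this).trans (card_insert_le _ _)
      omega

/-- A graph without a coloring has a small vertex cover of its pairs of non-adjacent vertices that
are not rich. -/
theorem exists_cover [Nonempty T] (hn : 30 * k ≤ Fintype.card V)
    (hno : ¬ ∃ c, IsColoringOn G L univ c) :
    ∃ D, D ⊆ (rich L k)ᶜ ∧ D.card < 2 * k ∧
      ∀ u ∉ rich L k, u ∉ D → ∀ v ∉ rich L k, v ∉ D → u ≠ v → G.Adj u v := by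
  rcases exists_cover_or_coloring (G := G) hL hn (card_highColors_lt hL hS) k le_rfl with
    h | ⟨D, c, h1, h2, h3, h4⟩
  · exact h
  refine absurd ?_ hno
  -- The 2k vertices of D use at most k colors. Each of the other n - 2k vertices thus retains n -
  -- 2k options, enough for distinct colors.
  obtain ⟨f, hf, hfO⟩ := exists_injOn_of_card_le Dᶜ (fun v => L v \ D.image c) (by
    intro v _
    have := hL v
    have := card_compl_add_card D
    have := le_card_sdiff (D.image c) (L v)
    omega)
  refine ⟨_, (h3.extend (t := Dᶜ) (fun v hv => (mem_sdiff.1 (hfO v hv)).1) hf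
    fun v hv u hu _ e => (mem_sdiff.1 (hfO v hv)).2 (e ▸ mem_image_of_mem c hu)).mono ?_⟩
  simp

end Violator

end ListColoring

namespace ListColoring

set_option linter.unusedSectionVars false

open Finset
open scoped Classical

/-! ### Extending a reduced coloring to the whole graph -/

section Lifting

variable {V T : Type*} [Fintype V] [Fintype T] [DecidableEq V] [DecidableEq T]
variable {G : SimpleGraph V} {L : V → Finset T} {k : ℕ}

variable (hL : ∀ v, (L v).card + k = Fintype.card V) {S : Finset V}
  (hS : (S.biUnion L).card < S.card) (hn : 30 * k ≤ Fintype.card V) {D : Finset V}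
  (hDr : D ⊆ (rich L k)ᶜ) (hDc : D.card < 2 * k)
  (hD : ∀ u ∉ rich L k, u ∉ D → ∀ v ∉ rich L k, v ∉ D → u ≠ v → G.Adj u v)

-- For a vertex outside D that is not rich, all counted non-neighbors lie in D or equal the vertex
-- itself: at most 2k of them, below the threshold 14k.
include hDc hD in
theorem heavy_subset : heavy G L k ⊆ D := by
  intro v hv
  simp only [heavy, mem_filter, mem_univ, true_and] at hv
  by_contra hvD
  have : nonAdj G L k v ⊆ insert v D := by
    intro u hu
    obtain ⟨hu, huv⟩ := mem_nonAdj.1 hu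
    by_contra h
    simp only [mem_insert, not_or] at h
    exact huv (hD v hv.1 hvD u hu h.2 (Ne.symm h.1))
  have := (card_le_card this).trans (card_insert_le _ _)
  omega

-- A vertex that is not plain is rich, lies in D, has a low color, or is not adjacent to a light
-- vertex of D. The last kind contributes at most 2k · 14k vertices, and low colors at most k +
-- 26k².
include hL hS hn hDc hD in
theorem card_compl_plain_le : (plain G L k)ᶜ.card ≤ 60 * k ^ 2 := by
  have h1 : (plain G L k)ᶜ ⊆ (rich L k ∪ D ∪ univ.filter fun v => ∃ c ∈ L v, c ∈ lowColors L k) ∪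
      (D \ heavy G L k ∩ light G L k).biUnion (nonAdj G L k) := by
    intro v hv
    simp only [mem_union, mem_filter, mem_univ, true_and, mem_biUnion]
    by_contra! h
    obtain ⟨⟨⟨h1, h2⟩, h3⟩, h4⟩ := h
    have hvl : v ∈ light G L k := mem_light.2 ⟨h1, fun h => h2 (heavy_subset hDc hD h)⟩
    refine mem_compl.1 hv (mem_plain.2 ⟨hvl, h3, fun u hu huv => ?_⟩)
    by_contra hadj
    have hu' := mem_light.1 hu
    by_cases huD : u ∈ D
    · exact h4 u (by simp [huD, hu, hu'.2])
        (mem_nonAdj.2 ⟨h1, fun h => hadj h.symm⟩)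
    · exact hadj (hD v h1 h2 u hu'.1 huD huv.symm)
  have h2 := (card_le_card h1).trans (card_union_le _ _)
  have h3 := card_union_le (rich L k ∪ D) (univ.filter fun v => ∃ c ∈ L v, c ∈ lowColors L k)
  have h4 := card_union_le (rich L k) D
  have h5 := card_rich_lt hL hS hn
  have h6 := card_meets_low_le hL hS hn
  have h7 := card_biUnion_le_card_mul (D \ heavy G L k ∩ light G L k) (nonAdj G L k) (14 * k)
    fun v hv => (card_nonAdj_lt (mem_inter.1 hv).2).le
  have h8 : (D \ heavy G L k ∩ light G L k).card ≤ 2 * k :=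
    (card_le_card (inter_subset_left.trans sdiff_subset)).trans hDc.le
  have h9 := Nat.mul_le_mul_right (14 * k) h8
  have h10 : 2 * k * (14 * k) = 28 * k ^ 2 := by ring
  have h11 : k ≤ k ^ 2 := Nat.le_self_pow two_ne_zero k
  omega

include hL hS hn in
/-- A coloring of the vertices that are not rich extends to the rich ones. -/
theorem exists_coloring_of_not_rich [Nonempty T] {c : V → T}
    (hc : IsColoringOn G L (rich L k)ᶜ c) : ∃ c, IsColoringOn G L univ c := by
  have hA := rich_subset hL hS hn
  -- Low colors outside N(S) cannot clash with S. At least 3k - 2(k - 1) are available to a rich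
  -- vertex, and the other vertices outside S block fewer than k - |rich|, leaving at least |rich|.
  obtain ⟨f, hf, hfO⟩ := exists_injOn_of_card_le (rich L k)
    (fun v => ((L v ∩ lowColors L k) \ (lowColors L k ∩ S.biUnion L)) \
      (Sᶜ \ rich L k).image c) (by
    intro v hv
    simp only [rich, mem_filter, mem_univ, true_and] at hv
    have h1 := card_low_inter_le hL hS hn
    have h2 := card_compl_lt hL hS
    have h3 := le_card_sdiff (lowColors L k ∩ S.biUnion L) (L v ∩ lowColors L k)
    have h4 := le_card_sdiff ((Sᶜ \ rich L k).image c)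
      ((L v ∩ lowColors L k) \ (lowColors L k ∩ S.biUnion L))
    have h5 : ((Sᶜ \ rich L k).image c).card ≤ (Sᶜ \ rich L k).card := card_image_le
    have h6 := card_sdiff_add_card_eq_card hA
    omega)
  refine ⟨_, (hc.extend (t := rich L k) (fun v hv => ?_) hf fun v hv u hu _ e => ?_).mono ?_⟩
  · have := hfO v hv
    simp only [mem_sdiff, mem_inter] at this
    exact this.1.1.1
  · have := hfO v hv
    simp only [mem_sdiff, mem_inter] at this
    by_cases huS : u ∈ S
    · exact this.1.2 ⟨this.1.1.2, mem_biUnion.2 ⟨u, huS, e ▸ hc.1 u hu⟩⟩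
    · exact this.2 (e ▸ mem_image_of_mem c (by simpa [huS] using hu))
  · intro v _
    by_cases h : v ∈ rich L k <;> simp [h]

include hL hS hn in
/-- A coloring uses few low colors on vertices with different colors. -/
theorem card_image_low_le {c : V → T} {s : Finset V} (hc : ∀ v ∈ s, c v ∈ L v) :
    (s.image c ∩ lowColors L k).card ≤ 3 * k := by
  have h1 : s.image c ∩ lowColors L k ⊆ (lowColors L k ∩ S.biUnion L) ∪ Sᶜ.image c := by
    intro q hq
    obtain ⟨hq, hql⟩ := mem_inter.1 hq
    obtain ⟨v, hv, rfl⟩ := mem_image.1 hq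
    by_cases hvS : v ∈ S
    · exact mem_union_left _ (mem_inter.2 ⟨hql, mem_biUnion.2 ⟨v, hvS, hc v hv⟩⟩)
    · exact mem_union_right _ (mem_image_of_mem c (by simpa using hvS))
  have h2 := (card_le_card h1).trans (card_union_le _ _)
  have h3 := card_low_inter_le hL hS hn
  have h4 := card_compl_lt hL hS
  have h5 : (Sᶜ.image c).card ≤ Sᶜ.card := card_image_le
  omega

include hL hS hn hDr hDc hD in
/-- A coloring of the light vertices extends to the heavy ones. -/
theorem exists_coloring_of_light [Nonempty T] {c : V → T}
    (hc : IsColoringOn G L (light G L k) c) : ∃ c, IsColoringOn G L (rich L k)ᶜ c := by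
  have hHD := heavy_subset hDc hD
  set C := (rich L k)ᶜ \ D with hC
  have hCl : C ⊆ light G L k := fun v hv => by
    simp only [hC, mem_sdiff, mem_compl] at hv
    exact mem_light.2 ⟨hv.1, fun h => hv.2 (hHD h)⟩
  have hinj : Set.InjOn c C := hc.injOn hCl fun u hu v hv huv => by
    simp only [hC, mem_sdiff, mem_compl] at hu hv
    exact hD u hu.1 hu.2 v hv.1 hv.2 huv
  -- A heavy vertex d reuses the color of a non-neighbor in the clique C: that color occurs only
  -- once in C, so only D can clash. More than 12k such colors exist; at most 4k high and 3k low
  -- ones are missing from L(d), and the remaining 5k exceed |D| < 2k.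
  obtain ⟨f, hf, hfO⟩ := exists_injOn_of_card_le (heavy G L k)
    (fun d => ((C ∩ nonAdj G L k d).image c ∩ L d) \ (D \ heavy G L k).image c) (by
    intro d hd
    have hd' := hd
    simp only [heavy, mem_filter, mem_univ, true_and] at hd'
    obtain ⟨hdr, hdn⟩ := hd'
    have h1 := le_card_sdiff ((D \ heavy G L k).image c) ((C ∩ nonAdj G L k d).image c ∩ L d)
    have h2 : ((D \ heavy G L k).image c).card ≤ (D \ heavy G L k).card := card_image_le
    have h3 := card_sdiff_add_card_eq_card hHD
    have h4 : ((C ∩ nonAdj G L k d).image c).card = (C ∩ nonAdj G L k d).card :=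
      card_image_of_injOn (hinj.mono (by simp))
    have h5 : (nonAdj G L k d).card ≤ (C ∩ nonAdj G L k d).card + D.card := by
      refine (card_le_card (t := (C ∩ nonAdj G L k d) ∪ D) fun u hu => ?_).trans
        (card_union_le _ _)
      by_cases huD : u ∈ D
      · simp [huD]
      · simp [hC, huD, hu, (mem_nonAdj.1 hu).1]
    have h6 := card_inter_add_card_sdiff ((C ∩ nonAdj G L k d).image c) (L d)
    have h7 : (C ∩ nonAdj G L k d).image c \ L d ⊆ (highColors L k \ L d) ∪
        ((C ∩ nonAdj G L k d).image c ∩ lowColors L k) := by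
      intro q hq
      simp only [mem_sdiff] at hq
      simp only [mem_union, mem_sdiff, mem_inter, mem_highColors]
      tauto
    have h8 := (card_le_card h7).trans (card_union_le _ _)
    have h9 := card_high_sdiff_le hL (card_highColors_lt hL hS) hdr
    have h10 := card_image_low_le hL hS hn (s := C ∩ nonAdj G L k d) (c := c)
      fun v hv => hc.1 v (hCl (mem_inter.1 hv).1)
    omega)
  refine ⟨_, (hc.extend (t := heavy G L k) (fun v hv => ?_) hf fun d hd u hu hadj e => ?_).mono ?_⟩
  · have := hfO v hv
    simp only [mem_sdiff, mem_inter] at this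
    exact this.1.2
  · have := hfO d hd
    simp only [mem_sdiff, mem_inter] at this
    obtain ⟨⟨h1, h2⟩, h3⟩ := this
    obtain ⟨v, hv, hvd⟩ := mem_image.1 h1
    obtain ⟨hvC, hvn⟩ := mem_inter.1 hv
    obtain ⟨hur, huh⟩ := mem_light.1 hu
    by_cases huD : u ∈ D
    · exact h3 (e ▸ mem_image_of_mem c (by simp [huD, huh]))
    · have : u = v := hinj (by simp [hC, hur, huD]) hvC (e.trans hvd.symm)
      subst this
      exact (mem_nonAdj.1 hvn).2 hadj.symm
  · intro v hv
    by_cases h : v ∈ heavy G L k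
    · simp [h]
    · simp only [mem_union, mem_light, h, or_false, not_false_eq_true, and_true]
      simpa using hv

include hL hS hn hDc hD in
/-- A coloring of the reduced instance yields one of the light vertices. -/
theorem exists_light_coloring [Nonempty T] {Q₀ : Finset T} {W₀ : Finset V}
    (hW₀ : W₀ ⊆ plain G L k)
    (hcW : W₀.card + (highColors L k).card = Q₀.card + (plain G L k).card)
    {c : V → T} (hc : IsColoringOn G (reducedList G L k Q₀) (core G L k ∪ W₀) c) :
    ∃ c, IsColoringOn G L (light G L k) c := by
  have hHD := heavy_subset hDc hD
  have hcL : ∀ v ∈ core G L k, c v ∈ L v ∧ (c v ∈ keptLow L k ∨ c v ∈ Q₀) := by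
    intro v hv
    have := hc.1 v (mem_union_left _ hv)
    rw [reducedList, if_neg (mem_core.1 hv).2] at this
    simpa using this
  have hcW₀ : ∀ v ∈ W₀, c v ∈ Q₀ := by
    intro v hv
    have := hc.1 v (mem_union_right _ hv)
    rwa [reducedList, if_pos (hW₀ hv)] at this
  set D' := core G L k ∩ D with hD'
  set C := core G L k \ D with hC
  have hadjC : ∀ u ∈ C ∪ W₀, ∀ v ∈ C ∪ W₀, u ≠ v → G.Adj u v := by
    intro u hu v hv huv
    have hl : ∀ x ∈ C ∪ W₀, x ∈ light G L k := by
      intro x hx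
      rcases mem_union.1 hx with hx | hx
      · exact (mem_core.1 (mem_sdiff.1 hx).1).1
      · exact (mem_plain.1 (hW₀ hx)).1
    have hul := hl u hu
    have hvl := hl v hv
    rcases mem_union.1 hu with hu | hu
    · rcases mem_union.1 hv with hv | hv
      · exact hD u (mem_light.1 hul).1 (mem_sdiff.1 hu).2 v (mem_light.1 hvl).1 (mem_sdiff.1 hv).2
          huv
      · exact ((mem_plain.1 (hW₀ hv)).2.2 u hul huv).symm
    · exact (mem_plain.1 (hW₀ hu)).2.2 v hvl huv.symm
  have hinj : Set.InjOn c (C ∪ W₀ : Finset V) := hc.injOn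
    (union_subset_union sdiff_subset subset_rfl) hadjC
  -- The part F keeps its colors. C₀ collects the clique vertices with a low color or a color
  -- repeated on D', so the colors of the other clique vertices and of W₀ are kept high colors
  -- absent from F.
  set C₀ := C.filter fun v => c v ∈ D'.image c ∨ c v ∈ lowColors L k with hC₀
  set F := D' ∪ C₀ with hF
  have hC₀c : C₀.card ≤ D'.card + 3 * k := by
    have h1 : C₀.card = (C₀.image c).card :=
      (card_image_of_injOn (hinj.mono fun v hv => by
        simp only [hC₀, coe_filter, Set.mem_ofPred_eq] at hv
        simp [hv.1])).symm
    have h2 : C₀.image c ⊆ D'.image c ∪ (C.image c ∩ lowColors L k) := by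
      intro q hq
      obtain ⟨v, hv, rfl⟩ := mem_image.1 hq
      obtain ⟨hv, h⟩ := mem_filter.1 hv
      rcases h with h | h
      · exact mem_union_left _ h
      · exact mem_union_right _ (mem_inter.2 ⟨mem_image_of_mem c hv, h⟩)
    have h3 := (card_le_card h2).trans (card_union_le _ _)
    have h4 : (D'.image c).card ≤ D'.card := card_image_le
    have h5 := card_image_low_le hL hS hn (s := C) (c := c) fun v hv =>
      (hcL v (mem_sdiff.1 hv).1).1
    omega
  have hFK : F ⊆ core G L k :=
    union_subset inter_subset_left ((filter_subset _ _).trans sdiff_subset)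
  have hFc : IsColoringOn G L F c :=
    ⟨fun v hv => (hcL v (hFK hv)).1, fun u hu v hv =>
      hc.2 u (mem_union_left _ (hFK hu)) v (mem_union_left _ (hFK hv))⟩
  set X := light G L k \ F with hX
  set Q' := highColors L k \ F.image c with hQ'
  -- On (C \ C₀) ∪ W₀ the coloring is injective into Q₀ minus the colors of F. As many plain
  -- vertices as high colors were deleted, by `hcW`, so this inequality survives when both are
  -- restored.
  have hcount : X.card ≤ Q'.card := by
    have h1 : ((C \ C₀) ∪ W₀).image c ⊆ Q₀ \ F.image c := by
      intro q hq
      obtain ⟨v, hv, rfl⟩ := mem_image.1 hq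
      have hvCW : v ∈ C ∪ W₀ := by
        rcases mem_union.1 hv with hv | hv
        · exact mem_union_left _ (mem_sdiff.1 hv).1
        · exact mem_union_right _ hv
      have hC₀' : c v ∉ C₀.image c := by
        intro h
        obtain ⟨u, hu, huv⟩ := mem_image.1 h
        have huC := (mem_filter.1 hu).1
        have : u = v := hinj (by simp [huC]) hvCW huv
        subst this
        rcases mem_union.1 hv with hv | hv
        · exact (mem_sdiff.1 hv).2 hu
        · exact (mem_core.1 (mem_sdiff.1 huC).1).2 (hW₀ hv)
      rw [mem_sdiff, hF, image_union, mem_union, not_or]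
      rcases mem_union.1 hv with hv | hv
      · obtain ⟨hvC, hvC₀⟩ := mem_sdiff.1 hv
        have h' : ¬ (c v ∈ D'.image c ∨ c v ∈ lowColors L k) := fun h =>
          hvC₀ (mem_filter.2 ⟨hvC, h⟩)
        rw [not_or] at h'
        refine ⟨?_, h'.1, hC₀'⟩
        rcases (hcL v (mem_sdiff.1 hvC).1).2 with h | h
        · exact absurd (mem_keptLow.1 h).1 h'.2
        · exact h
      · refine ⟨hcW₀ v hv, fun h => ?_, hC₀'⟩
        obtain ⟨u, hu, huv⟩ := mem_image.1 h
        have huK := (mem_inter.1 hu).1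
        refine hc.2 v (mem_union_right _ hv) u (mem_union_left _ huK)
          ((mem_plain.1 (hW₀ hv)).2.2 u (mem_core.1 huK).1 ?_) huv.symm
        rintro rfl
        exact (mem_core.1 huK).2 (hW₀ hv)
    have h2 := card_le_card h1
    rw [card_image_of_injOn (hinj.mono (by
      rw [coe_subset]; exact union_subset_union sdiff_subset subset_rfl)),
      card_union_of_disjoint (by
        rw [Finset.disjoint_left]
        intro v hv hv'
        exact (mem_core.1 (mem_sdiff.1 (mem_sdiff.1 hv).1).1).2 (hW₀ hv'))] at h2
    have h3 : X ⊆ plain G L k ∪ (C \ C₀) := by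
      intro v hv
      obtain ⟨hvl, hvF⟩ := mem_sdiff.1 hv
      simp only [hF, mem_union, not_or] at hvF
      by_cases hvp : v ∈ plain G L k
      · simp [hvp]
      · have hvK : v ∈ core G L k := mem_core.2 ⟨hvl, hvp⟩
        have hvD : v ∉ D := fun h => hvF.1 (mem_inter.2 ⟨hvK, h⟩)
        exact mem_union_right _ (mem_sdiff.2 ⟨mem_sdiff.2 ⟨hvK, hvD⟩, hvF.2⟩)
    have h4 := (card_le_card h3).trans (card_union_le _ _)
    have h5 : highColors L k ∩ F.image c ⊆ Q₀ ∩ F.image c := by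
      intro q hq
      obtain ⟨hq, hqF⟩ := mem_inter.1 hq
      obtain ⟨v, hv, rfl⟩ := mem_image.1 hqF
      refine mem_inter.2 ⟨?_, hqF⟩
      rcases (hcL v (hFK hv)).2 with h | h
      · exact absurd (mem_keptLow.1 h).1 (mem_highColors.1 hq)
      · exact h
    have h6 := card_le_card h5
    have h7 := card_inter_add_card_sdiff (highColors L k) (F.image c)
    rw [← hQ'] at h7
    have h8 := card_inter_add_card_sdiff Q₀ (F.image c)
    omega
  have hnotrich : ∀ v ∈ X, v ∉ rich L k := fun v hv => (mem_light.1 (mem_sdiff.1 hv).1).1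
  -- Hall's condition: if s misses a color q of Q', then q lies in at least 13k lists, fewer than 8k
  -- of them in rich ∪ D ∪ C₀. So |X \ s| > 5k, while one vertex of s already sees |Q'| - 4k ≥ |X| -
  -- 4k colors.
  obtain ⟨f, hf, hfO⟩ := exists_injOn_of_hall X (fun v => L v ∩ Q') (by
    intro s hs
    rcases s.eq_empty_or_nonempty with rfl | ⟨v, hv⟩
    · simp
    by_cases hsub : Q' ⊆ s.biUnion fun v => L v ∩ Q'
    · exact (card_le_card hs).trans (hcount.trans (card_le_card hsub))
    · obtain ⟨q, hq, hqs⟩ := not_subset.1 hsub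
      have h1 : vertsOf L q ⊆ (rich L k ∪ D ∪ C₀) ∪ (X \ s) := by
        intro u hu
        have hqu : q ∈ L u := by simpa [vertsOf] using hu
        simp only [mem_union, mem_sdiff]
        by_contra! h
        obtain ⟨⟨⟨h1, h2⟩, h3⟩, h4⟩ := h
        have huX : u ∈ X := by
          rw [hX, mem_sdiff, mem_light, hF, mem_union, not_or]
          exact ⟨⟨h1, fun h => h2 (hHD h)⟩, fun h => h2 (mem_inter.1 h).2, h3⟩
        exact hqs (mem_biUnion.2 ⟨u, h4 huX, mem_inter.2 ⟨hqu, hq⟩⟩)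
      have h2 := (card_le_card h1).trans (card_union_le _ _)
      have h3 := card_union_le (rich L k ∪ D) C₀
      have h4 := card_union_le (rich L k) D
      have h5 := card_rich_lt hL hS hn
      have h6 : D'.card ≤ D.card := card_le_card inter_subset_right
      have h7 : ¬ (vertsOf L q).card < 13 * k := by
        have := (mem_sdiff.1 hq).1
        simpa [highColors] using this
      have h8 := card_sdiff_add_card_eq_card hs
      have h9 := card_le_card (subset_biUnion_of_mem (fun v => L v ∩ Q') hv)
      have h10 := card_high_sdiff_le hL (card_highColors_lt hL hS) (hnotrich v (hs hv))
      have h11 := card_sdiff_add_card_inter Q' (L v)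
      rw [inter_comm] at h11
      have h12 : (Q' \ L v).card ≤ (highColors L k \ L v).card :=
        card_le_card (sdiff_subset_sdiff sdiff_subset subset_rfl)
      omega)
  refine ⟨_, (hFc.extend (t := X) (fun v hv => (mem_inter.1 (hfO v hv)).1) hf
    fun v hv u hu _ e => (mem_sdiff.1 (mem_inter.1 (hfO v hv)).2).2
      (e ▸ mem_image_of_mem c hu)).mono ?_⟩
  intro v hv
  by_cases h : v ∈ F <;> simp [hX, h, hv]

end Lifting

/-! ### Combining the bounds with the two directions -/

section Equivalence

variable {V T : Type*} [Fintype V] [Fintype T] [DecidableEq V] [DecidableEq T]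
variable {G : SimpleGraph V} {L : V → Finset T} {k : ℕ}

/-- The sizes for which the reduced instance is used. -/
def Bounded (G : SimpleGraph V) (L : V → Finset T) (k : ℕ) : Prop :=
  (highColors L k).card < Fintype.card V ∧ (plain G L k)ᶜ.card ≤ 60 * k ^ 2 ∧
    (keptLow L k).card ≤ 6 * k ^ 2

/-- Graphs without a coloring satisfy the bounds, and the reduction keeps them. -/
theorem bounded_and_not_reduced [Nonempty T] (hL : ∀ v, (L v).card + k = Fintype.card V)
    (hn : 30 * k ≤ Fintype.card V) (hno : ¬ ∃ c, IsColoringOn G L univ c) :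
    Bounded G L k ∧ ∀ (Q₀ : Finset T) (W₀ : Finset V), W₀ ⊆ plain G L k →
      Q₀.card = min (highColors L k).card (120 * k ^ 2) →
      W₀.card = Q₀.card + (plain G L k).card - (highColors L k).card →
      ¬ ∃ c, IsColoringOn G (reducedList G L k Q₀) (core G L k ∪ W₀) c := by
  have hhall : ∃ S : Finset V, (S.biUnion L).card < S.card := by
    by_contra! h
    exact hno (exists_coloring_of_hall h)
  obtain ⟨S, hS⟩ := hhall
  obtain ⟨D, hDr, hDc, hD⟩ := exists_cover hL hS hn hno
  have hQ := card_highColors_lt hL hS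
  have hW := card_compl_plain_le hL hS hn hDc hD
  refine ⟨⟨hQ, hW, card_keptLow_le hL hS hn⟩, ?_⟩
  rintro Q₀ W₀ hW₀ hcQ hcW ⟨c, hc⟩
  -- Since |high| < n ≤ |plain| + 60k², the truncated subtraction defining |W₀| is exact.
  have h1 := card_compl_add_card (plain G L k)
  obtain ⟨c₁, hc₁⟩ := exists_light_coloring hL hS hn hDc hD hW₀ (by omega) hc
  obtain ⟨c₂, hc₂⟩ := exists_coloring_of_light hL hS hn hDr hDc hD hc₁
  exact hno (exists_coloring_of_not_rich hL hS hn hc₂)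

end Equivalence

end ListColoring

namespace Machine

/-! ### Properties of selections and tables -/

theorem mem_sel {n : ℕ} {p : ℕ → Bool} {i : ℕ} : i ∈ sel n p ↔ i < n ∧ p i = true := by
  simp [sel]

theorem nodup_sel (n : ℕ) (p : ℕ → Bool) : (sel n p).Nodup := List.nodup_range.filter _

theorem sel_getD_mem {n : ℕ} {p : ℕ → Bool} {i : ℕ} (hi : i < (sel n p).length) :
    (sel n p).getD i 0 < n ∧ p ((sel n p).getD i 0) = true := by
  rw [List.getD_eq_getElem _ _ hi, ← mem_sel]
  exact List.getElem_mem hi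

theorem sel_getD_inj {n : ℕ} {p : ℕ → Bool} {i j : ℕ} (hi : i < (sel n p).length)
    (hj : j < (sel n p).length) (h : (sel n p).getD i 0 = (sel n p).getD j 0) : i = j := by
  rw [List.getD_eq_getElem _ _ hi, List.getD_eq_getElem _ _ hj] at h
  exact (nodup_sel n p).getElem_inj_iff.1 h

theorem exists_sel_getD {n : ℕ} {p : ℕ → Bool} {v : ℕ} (hv : v < n) (hp : p v = true) :
    ∃ i < (sel n p).length, (sel n p).getD i 0 = v := by
  obtain ⟨i, hi, h⟩ := List.mem_iff_getElem.1 (mem_sel.2 ⟨hv, hp⟩)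
  exact ⟨i, hi, by rw [List.getD_eq_getElem _ _ hi, h]⟩

theorem countN_congr {n : ℕ} {p q : ℕ → Bool} (h : ∀ i < n, p i = q i) :
    countN n p = countN n q := by
  unfold countN sel
  rw [List.filter_congr fun i hi => h i (List.mem_range.1 hi)]

theorem countN_add (a b : ℕ) (p : ℕ → Bool) :
    countN (a + b) p = countN a p + countN b (fun i => p (a + i)) := by
  unfold countN sel
  rw [List.range_add, List.filter_append, List.length_append, List.filter_map, List.length_map]
  rfl

theorem countN_le (n : ℕ) (p : ℕ → Bool) : countN n p ≤ n := by
  simpa [countN, sel] using List.length_filter_le p (List.range n)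

theorem countN_true (n : ℕ) : countN n (fun _ => true) = n := by
  simp [countN, sel]

theorem countN_false (n : ℕ) : countN n (fun _ => false) = 0 := by
  simp [countN, sel]

theorem countN_succ (n : ℕ) (p : ℕ → Bool) : countN (n + 1) p = countN n p + (p n).toNat := by
  rw [countN_add]
  cases h : p n <;> simp [countN, sel, h]

theorem countN_ltB (n a : ℕ) : countN n (fun i => ltB i a) = min n a := by
  induction n with
  | zero => simp [countN, sel]
  | succ n ih =>
    rw [countN_succ, ih]
    by_cases h : n < a
    · simp [ltB, h]; omega
    · simp [ltB, h]; omega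

/-- Among the numbers that satisfy `p`, those preceded by fewer than `a` of them. -/
theorem countN_first (n a : ℕ) (p : ℕ → Bool) :
    countN n (fun i => p i && ltB (countN i p) a) = min (countN n p) a := by
  induction n with
  | zero => simp [countN, sel]
  | succ n ih =>
    rw [countN_succ, countN_succ, ih]
    cases hp : p n
    · simp
    · by_cases h : countN n p < a
      · simp [ltB, h]; omega
      · simp [ltB, h]; omega

/-- The bridge from counting by the program to cardinalities of finite sets. -/
theorem countN_eq_card (n : ℕ) (p : ℕ → Bool) :
    countN n p = (Finset.univ.filter fun i : Fin n => p i = true).card := by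
  induction n with
  | zero => simp [countN, sel]
  | succ n ih =>
    rw [countN_succ, ih, Finset.card_filter, Finset.card_filter, Fin.sum_univ_castSucc]
    cases h : p n <;> simp [h]

theorem anyN_eq_true {n : ℕ} {p : ℕ → Bool} : anyN n p = true ↔ ∃ i : Fin n, p i = true := by
  rw [anyN, ltB_eq_true, countN_eq_card, Finset.card_pos]
  simp [Finset.Nonempty]

theorem tabulate_eq_ofFn {γ : Type} (n : ℕ) (g : ℕ → γ) :
    tabulate n g = List.ofFn fun i : Fin n => g i := by
  simp [tabulate, List.ofFn_eq_map, ← List.map_coe_finRange_eq_range]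

theorem ofFn_getD {γ : Type} {n : ℕ} (g : Fin n → γ) (d : γ) (i : Fin n) :
    (List.ofFn g).getD i d = g i := by
  rw [List.getD_eq_getElem _ _ (by simp)]
  simp

end Machine

/-! ### The kernelization as a program on raw data -/

namespace RegularListColoring

open Machine

/-- An instance as written on the input: the numbers `n`, `m`, `k` and the two matrices. -/
abbrev Raw : Type := ℕ × ℕ × ℕ × List (List Bool) × List (List Bool) × Unit

namespace Raw

variable (x : Raw)

/-- Adjacency of two vertices. -/
def adj (u v : ℕ) : Bool := (x.2.2.2.1.getD u []).getD v false

/-- Membership of a color in the list of a vertex. -/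
def mem (v c : ℕ) : Bool := (x.2.2.2.2.1.getD v []).getD c false

/-- Colors in few lists. -/
def isLow (c : ℕ) : Bool := ltB (countN x.1 fun v => x.mem v c) (13 * x.2.2.1)

/-- Vertices with many low colors. -/
def isRich (v : ℕ) : Bool := !ltB (countN x.2.1 fun c => x.mem v c && x.isLow c) (3 * x.2.2.1)

/-- Vertices with many non-neighbors. -/
def isHeavy (v : ℕ) : Bool :=
  !x.isRich v && !ltB (countN x.1 fun u => !x.isRich u && !x.adj v u) (14 * x.2.2.1)

/-- Vertices that are neither rich nor heavy. -/
def isLight (v : ℕ) : Bool := !x.isRich v && !x.isHeavy v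

/-- Light vertices without low colors and adjacent to all other light vertices. -/
def isPlain (v : ℕ) : Bool :=
  x.isLight v && !anyN x.2.1 (fun c => x.mem v c && x.isLow c) &&
    !anyN x.1 (fun u => x.isLight u && (ltB u v || ltB v u) && !x.adj v u)

/-- Low colors in lists of vertices that are not rich. -/
def isKeptLow (c : ℕ) : Bool := x.isLow c && anyN x.1 fun v => !x.isRich v && x.mem v c

/-- Whether there are few vertices in comparison with `k`. -/
def isSmall : Bool := ltB x.1 (30 * x.2.2.1)

/-- The number of colors that are not low. -/
def numHigh : ℕ := countN x.2.1 fun c => !x.isLow c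

/-- The number of plain vertices. -/
def numPlain : ℕ := countN x.1 x.isPlain

/-- Whether the reduced instance is small enough to be used. -/
def isBounded : Bool :=
  ltB x.numHigh x.1 && ltB (x.1 - x.numPlain) (60 * (x.2.2.1 * x.2.2.1) + 1) &&
    ltB (countN x.2.1 x.isKeptLow) (6 * (x.2.2.1 * x.2.2.1) + 1)

/-- The number of high colors that are kept. -/
def quota : ℕ := min x.numHigh (120 * (x.2.2.1 * x.2.2.1))

/-- The first high colors, as many as the quota. -/
def isKeptHigh (c : ℕ) : Bool := !x.isLow c && ltB (countN c fun d => !x.isLow d) x.quota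

/-- The first plain vertices. -/
def isKeptPlain (v : ℕ) : Bool :=
  x.isPlain v && ltB (countN v x.isPlain) (x.quota + x.numPlain - x.numHigh)

/-- The vertices that are kept. -/
def keepV (v : ℕ) : Bool :=
  cond x.isSmall true (x.isBounded && (x.isLight v && !x.isPlain v || x.isKeptPlain v))

/-- The colors that are kept. -/
def keepC (c : ℕ) : Bool :=
  cond x.isSmall (anyN x.1 fun v => x.mem v c) (x.isBounded && (x.isKeptLow c || x.isKeptHigh c))

/-- The new lists, on the colors that are kept. -/
def newMem (v c : ℕ) : Bool := cond (!x.isSmall && x.isPlain v) (x.isKeptHigh c) (x.mem v c)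

/-- The list of the vertices that are kept. -/
def vs : List ℕ := sel x.1 x.keepV

/-- The list of the colors that are kept. -/
def cs : List ℕ := sel x.2.1 x.keepC

end Raw

/-- The graph on the positions in the list `vs`, followed by vertices adjacent to all others. -/
def padAdj (a : ℕ → ℕ → Bool) (vs : List ℕ) (i j : ℕ) : Bool :=
  cond (ltB i vs.length && ltB j vs.length) (a (vs.getD i 0) (vs.getD j 0)) (ltB i j || ltB j i)

/-- Lists of the same length as `cs`: the lists on the positions in `cs` are filled up with new
colors, and all new colors form the lists of the new vertices. -/
def padMem (b : ℕ → ℕ → Bool) (vs cs : List ℕ) (i c : ℕ) : Bool :=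
  cond (ltB i vs.length)
    (cond (ltB c cs.length) (b (vs.getD i 0) (cs.getD c 0))
      (ltB (c - cs.length)
        (cs.length - countN cs.length fun j => b (vs.getD i 0) (cs.getD j 0))))
    (!ltB c cs.length)

namespace Raw

/-- The kernel, as written on the output. -/
def kernel (x : Raw) : Raw :=
  (x.vs.length + x.cs.length, x.cs.length + x.cs.length, x.vs.length,
    tabulate (x.vs.length + x.cs.length) (fun i => tabulate (x.vs.length + x.cs.length)
      fun j => padAdj x.adj x.vs i j),
    tabulate (x.vs.length + x.cs.length) (fun i => tabulate (x.cs.length + x.cs.length)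
      fun c => padMem x.newMem x.vs x.cs i c), ())

theorem pt_adj : PT fun y : Raw × ℕ × ℕ => adj y.1 y.2.1 y.2.2 := by unfold adj; fun_prop
theorem pt_mem : PT fun y : Raw × ℕ × ℕ => mem y.1 y.2.1 y.2.2 := by unfold mem; fun_prop

@[fun_prop]
theorem pt_adj' {α : Type} [Enc α] {f : α → Raw} {g h : α → ℕ} (hf : PT f) (hg : PT g)
    (hh : PT h) : PT fun a => adj (f a) (g a) (h a) := by
  have := pt_adj.comp (hf.pair (hg.pair hh))
  exact this

@[fun_prop]
theorem pt_mem' {α : Type} [Enc α] {f : α → Raw} {g h : α → ℕ} (hf : PT f) (hg : PT g)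
    (hh : PT h) : PT fun a => mem (f a) (g a) (h a) := by
  have := pt_mem.comp (hf.pair (hg.pair hh))
  exact this

section
variable {α : Type} [Enc α] {f : α → Raw} {g h : α → ℕ}

@[fun_prop] theorem pt_isLow (hf : PT f) (hg : PT g) : PT fun a => isLow (f a) (g a) := by
  have : PT fun y : Raw × ℕ => isLow y.1 y.2 := by unfold isLow; fun_prop
  have := this.comp (hf.pair hg)
  exact this
@[fun_prop] theorem pt_isRich (hf : PT f) (hg : PT g) : PT fun a => isRich (f a) (g a) := by
  have : PT fun y : Raw × ℕ => isRich y.1 y.2 := by unfold isRich; fun_prop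
  have := this.comp (hf.pair hg)
  exact this
@[fun_prop] theorem pt_isHeavy (hf : PT f) (hg : PT g) : PT fun a => isHeavy (f a) (g a) := by
  have : PT fun y : Raw × ℕ => isHeavy y.1 y.2 := by unfold isHeavy; fun_prop
  have := this.comp (hf.pair hg)
  exact this
@[fun_prop] theorem pt_isLight (hf : PT f) (hg : PT g) : PT fun a => isLight (f a) (g a) := by
  have : PT fun y : Raw × ℕ => isLight y.1 y.2 := by unfold isLight; fun_prop
  have := this.comp (hf.pair hg)
  exact this
@[fun_prop] theorem pt_isPlain (hf : PT f) (hg : PT g) : PT fun a => isPlain (f a) (g a) := by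
  have : PT fun y : Raw × ℕ => isPlain y.1 y.2 := by unfold isPlain; fun_prop
  have := this.comp (hf.pair hg)
  exact this
@[fun_prop] theorem pt_isKeptLow (hf : PT f) (hg : PT g) : PT fun a => isKeptLow (f a) (g a) := by
  have : PT fun y : Raw × ℕ => isKeptLow y.1 y.2 := by unfold isKeptLow; fun_prop
  have := this.comp (hf.pair hg)
  exact this
@[fun_prop] theorem pt_isSmall (hf : PT f) : PT fun a => isSmall (f a) := by
  unfold isSmall; fun_prop
@[fun_prop] theorem pt_numHigh (hf : PT f) : PT fun a => numHigh (f a) := by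
  have : PT numHigh := by unfold numHigh; fun_prop
  have := this.comp hf
  exact this
@[fun_prop] theorem pt_numPlain (hf : PT f) : PT fun a => numPlain (f a) := by
  have : PT numPlain := by unfold numPlain; fun_prop
  have := this.comp hf
  exact this
@[fun_prop] theorem pt_isBounded (hf : PT f) : PT fun a => isBounded (f a) := by
  have : PT isBounded := by unfold isBounded; fun_prop
  have := this.comp hf
  exact this
@[fun_prop] theorem pt_quota (hf : PT f) : PT fun a => quota (f a) := by
  have : PT quota := by unfold quota; fun_prop
  have := this.comp hf
  exact this
@[fun_prop] theorem pt_isKeptHigh (hf : PT f) (hg : PT g) :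
    PT fun a => isKeptHigh (f a) (g a) := by
  have : PT fun y : Raw × ℕ => isKeptHigh y.1 y.2 := by unfold isKeptHigh; fun_prop
  have := this.comp (hf.pair hg)
  exact this
@[fun_prop] theorem pt_isKeptPlain (hf : PT f) (hg : PT g) :
    PT fun a => isKeptPlain (f a) (g a) := by
  have : PT fun y : Raw × ℕ => isKeptPlain y.1 y.2 := by unfold isKeptPlain; fun_prop
  have := this.comp (hf.pair hg)
  exact this
@[fun_prop] theorem pt_keepV (hf : PT f) (hg : PT g) : PT fun a => keepV (f a) (g a) := by
  have : PT fun y : Raw × ℕ => keepV y.1 y.2 := by unfold keepV; fun_prop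
  have := this.comp (hf.pair hg)
  exact this
@[fun_prop] theorem pt_keepC (hf : PT f) (hg : PT g) : PT fun a => keepC (f a) (g a) := by
  have : PT fun y : Raw × ℕ => keepC y.1 y.2 := by unfold keepC; fun_prop
  have := this.comp (hf.pair hg)
  exact this
@[fun_prop] theorem pt_newMem (hf : PT f) (hg : PT g) (hh : PT h) :
    PT fun a => newMem (f a) (g a) (h a) := by
  have : PT fun y : Raw × ℕ × ℕ => newMem y.1 y.2.1 y.2.2 := by unfold newMem; fun_prop
  have := this.comp (hf.pair (hg.pair hh))
  exact this
@[fun_prop] theorem pt_vs (hf : PT f) : PT fun a => vs (f a) := by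
  have : PT vs := by unfold vs; fun_prop
  have := this.comp hf
  exact this
@[fun_prop] theorem pt_cs (hf : PT f) : PT fun a => cs (f a) := by
  have : PT cs := by unfold cs; fun_prop
  have := this.comp hf
  exact this
theorem pt_kernel : PT kernel := by
  unfold kernel padAdj padMem; fun_prop
end

end Raw

end RegularListColoring

namespace RegularListColoring

open Machine ListColoring Finset
open scoped Classical

/-! ### Padding irregular lists to a regular instance -/

section Pad

variable {a b : ℕ → ℕ → Bool} {vs cs : List ℕ}

/-- An old vertex receives exactly as many new colors as it lacks old ones, and a new vertex has all
new colors. Both lists have |cs| = (|vs| + |cs|) - |vs| colors, which is why the new parameter is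
|vs|. -/
theorem countN_padMem (b : ℕ → ℕ → Bool) (vs cs : List ℕ) (i : ℕ) :
    countN (cs.length + cs.length) (padMem b vs cs i) = cs.length := by
  rw [countN_add]
  by_cases hi : i < vs.length
  · have h1 : countN cs.length (padMem b vs cs i) =
        countN cs.length fun j => b (vs.getD i 0) (cs.getD j 0) :=
      countN_congr fun j hj => by simp [padMem, ltB, hi, hj]
    have h2 : countN cs.length (fun j => padMem b vs cs i (cs.length + j)) =
        countN cs.length fun j => ltB j
          (cs.length - countN cs.length fun j => b (vs.getD i 0) (cs.getD j 0)) :=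
      countN_congr fun j hj => by simp [padMem, ltB, hi]
    have h3 := countN_le cs.length fun j => b (vs.getD i 0) (cs.getD j 0)
    rw [h1, h2, countN_ltB]
    omega
  · have h1 : countN cs.length (padMem b vs cs i) = countN cs.length fun _ => false :=
      countN_congr fun j hj => by simp [padMem, ltB, hi, hj]
    have h2 : countN cs.length (fun j => padMem b vs cs i (cs.length + j)) =
        countN cs.length fun _ => true :=
      countN_congr fun j hj => by simp [padMem, ltB, hi]
    rw [h1, h2, countN_true, countN_false, zero_add]

/-- The regular instance obtained by padding from a graph on `vs` with lists on `cs`. -/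
noncomputable def pad (a b : ℕ → ℕ → Bool) (vs cs : List ℕ) (ha : ∀ u v, a u v = a v u)
    (ha' : ∀ u, a u u = false) : RegularListColoring where
  n := vs.length + cs.length
  m := cs.length + cs.length
  k := vs.length
  G :=
    { Adj := fun i j => padAdj a vs i j = true
      symm := ⟨fun i j h => by
        rw [← h, padAdj, padAdj, ha, Bool.and_comm, Bool.or_comm]⟩
      loopless := ⟨fun i => by
        simp only [padAdj, ha', ltB]
        cases decide ((i : ℕ) < vs.length) <;> simp⟩ }
  L := fun i => univ.filter fun c => padMem b vs cs i c = true
  card_add := fun i => by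
    rw [← countN_eq_card, countN_padMem, add_comm]

variable {ha : ∀ u v, a u v = a v u} {ha' : ∀ u, a u u = false} {n m : ℕ} {p q : ℕ → Bool}
  {G : SimpleGraph (Fin n)}

/-- The old vertices keep their old colors and the new clique takes the new colors in order, so old
and new never clash. -/
theorem pad_hasListColoring (hG : ∀ u v : Fin n, a u v = true ↔ G.Adj u v) {c : Fin n → Fin m}
    (hc : IsColoringOn G (fun v => univ.filter fun c : Fin m => q c = true ∧ b v c = true)
      (univ.filter fun v : Fin n => p v = true) c) :
    (pad a b (sel n p) (sel m q) ha ha').HasListColoring := by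
  set vs := sel n p with hvs
  set cs := sel m q with hcs
  have hv : ∀ i < vs.length, ∃ v : Fin n, (v : ℕ) = vs.getD i 0 ∧ p v = true := by
    intro i hi
    obtain ⟨h1, h2⟩ := sel_getD_mem hi
    exact ⟨⟨_, h1⟩, rfl, h2⟩
  have hcol : ∀ i : Fin (vs.length + cs.length), ∃ j : Fin (cs.length + cs.length),
      (i < vs.length → j < cs.length ∧ ∃ v : Fin n, (v : ℕ) = vs.getD i 0 ∧ p v = true ∧
        cs.getD j 0 = c v) ∧ (¬ i < vs.length → (j : ℕ) + vs.length = cs.length + i) := by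
    intro i
    by_cases hi : i < vs.length
    · obtain ⟨v, hvi, hpv⟩ := hv i hi
      have := hc.1 v (by simpa using hpv)
      simp only [mem_filter, mem_univ, true_and] at this
      obtain ⟨j, hj, hjc⟩ := exists_sel_getD (c v).2 this.1
      rw [← hcs] at hj hjc
      exact ⟨⟨j, by omega⟩, fun _ => ⟨hj, v, hvi, hpv, hjc⟩, fun h => absurd hi h⟩
    · exact ⟨⟨cs.length + i - vs.length, by omega⟩, fun h => absurd h hi, fun _ => by
        dsimp only; omega⟩
  choose f hf₁ hf₂ using hcol
  refine ⟨⟨f, ?_⟩, ?_⟩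
  · intro i j hij heq
    change padAdj a vs i j = true at hij
    by_cases hi : (i : ℕ) < vs.length <;> by_cases hj : (j : ℕ) < vs.length
    · obtain ⟨_, u, hu, hpu, hcu⟩ := hf₁ i hi
      obtain ⟨_, v, hv, hpv, hcv⟩ := hf₁ j hj
      simp only [padAdj, ltB, hi, hj, decide_true, Bool.and_self, cond_true, ← hu, ← hv] at hij
      refine hc.2 u (by simpa using hpu) v (by simpa using hpv) ((hG u v).1 hij) (Fin.ext ?_)
      rw [← hcu, ← hcv, heq]
    · have h1 := (hf₁ i hi).1
      have h2 := hf₂ j hj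
      rw [heq] at h1
      omega
    · have h1 := (hf₁ j hj).1
      have h2 := hf₂ i hi
      rw [heq] at h2
      omega
    · have h1 := hf₂ i hi
      have h2 := hf₂ j hj
      have : (i : ℕ) = j := by rw [heq] at h1; omega
      simp [padAdj, ltB, this] at hij
      exact hj hij.1
  · intro i
    change f i ∈ univ.filter _
    simp only [mem_filter, mem_univ, true_and]
    by_cases hi : (i : ℕ) < vs.length
    · obtain ⟨hj, v, hvi, hpv, hcv⟩ := hf₁ i hi
      have := hc.1 v (by simpa using hpv)
      simp only [mem_filter, mem_univ, true_and] at this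
      simp only [padMem, ltB, hi, hj, decide_true, cond_true]
      rw [← hvi, hcv]
      exact this.2
    · have h2 := hf₂ i hi
      have : ¬ (f i : ℕ) < cs.length := by omega
      simp [padMem, ltB, hi, this]

/-- The new clique has |cs| vertices and only the |cs| new colors, so it uses each of them. Being
joined to everything, it forces the old vertices back to old colors. -/
theorem exists_coloring_of_pad (hG : ∀ u v : Fin n, a u v = true ↔ G.Adj u v) (d : Fin n → Fin m)
    (h : (pad a b (sel n p) (sel m q) ha ha').HasListColoring) :
    ∃ c : Fin n → Fin m,
      IsColoringOn G (fun v => univ.filter fun c : Fin m => q c = true ∧ b v c = true)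
        (univ.filter fun v : Fin n => p v = true) c := by
  obtain ⟨vs, hvs⟩ : ∃ vs, vs = sel n p := ⟨_, rfl⟩
  obtain ⟨cs, hcs⟩ : ∃ cs, cs = sel m q := ⟨_, rfl⟩
  have hmem : ∀ {i}, i < cs.length → cs.getD i 0 < m ∧ q (cs.getD i 0) = true := by
    rw [hcs]
    exact sel_getD_mem
  have hinj : ∀ {i j}, i < cs.length → j < cs.length → cs.getD i 0 = cs.getD j 0 → i = j := by
    rw [hcs]
    exact sel_getD_inj
  rw [← hvs, ← hcs] at h
  obtain ⟨f, hf, hfL⟩ : ∃ f : Fin (vs.length + cs.length) → Fin (cs.length + cs.length),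
      (∀ {i j : Fin _}, padAdj a vs i j = true → f i ≠ f j) ∧
        ∀ i : Fin _, padMem b vs cs i (f i) = true := by
    obtain ⟨F, hF⟩ := h
    exact ⟨F, fun h => F.valid h, fun i => (mem_filter.1 (hF i)).2⟩
  have hnew : ∀ i : Fin cs.length, cs.length ≤ (f (Fin.natAdd vs.length i) : ℕ) := fun i => by
    have := hfL (Fin.natAdd vs.length i)
    simpa [padMem, ltB] using this
  have hsurj : ∀ j : ℕ, cs.length ≤ j → j < cs.length + cs.length →
      ∃ i : Fin cs.length, (f (Fin.natAdd vs.length i) : ℕ) = j := by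
    set g : Fin cs.length → Fin cs.length := fun i =>
      ⟨f (Fin.natAdd vs.length i) - cs.length, by have := hnew i; omega⟩ with hg
    have hginj : Function.Injective g := by
      intro i j hij
      by_contra hne
      refine hf (i := Fin.natAdd vs.length i) (j := Fin.natAdd vs.length j) ?_ ?_
      · have : (i : ℕ) < j ∨ (j : ℕ) < i := by
          have := fun h => hne (Fin.ext h)
          omega
        simpa [padAdj, ltB] using this
      · have h1 := hnew i
        have h2 := hnew j
        have := congrArg Fin.val hij
        simp only [hg] at this
        exact Fin.ext (by omega)
    intro j hj hj'
    obtain ⟨i, hi⟩ := (Finite.injective_iff_surjective.1 hginj) ⟨j - cs.length, by omega⟩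
    refine ⟨i, ?_⟩
    have h1 := hnew i
    have := congrArg Fin.val hi
    simp only [hg] at this
    omega
  have hold : ∀ i : Fin (vs.length + cs.length), (i : ℕ) < vs.length → (f i : ℕ) < cs.length := by
    intro i hi
    by_contra hge
    obtain ⟨j, hj⟩ := hsurj (f i) (by omega) (f i).2
    refine hf (i := i) (j := Fin.natAdd vs.length j) ?_ (Fin.ext hj.symm)
    simp [padAdj, ltB]
    omega
  have hcol : ∀ v : Fin n, ∃ x : Fin m, p v = true →
      ∃ i : Fin (vs.length + cs.length), (i : ℕ) < vs.length ∧ vs.getD i 0 = v ∧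
        (x : ℕ) = cs.getD (f i) 0 := by
    intro v
    by_cases hv : p v = true
    · obtain ⟨i, hi, hiv⟩ := exists_sel_getD v.2 hv
      rw [← hvs] at hi hiv
      have := hmem (hold ⟨i, by omega⟩ hi)
      exact ⟨⟨_, this.1⟩, fun _ => ⟨⟨i, by omega⟩, hi, hiv, rfl⟩⟩
    -- Vertices that are not selected take an irrelevant default; no color need exist otherwise.
    · exact ⟨d v, fun h => absurd h hv⟩
  choose c hc using hcol
  refine ⟨c, fun v hv => ?_, fun u hu v hv huv heq => ?_⟩
  · simp only [mem_filter, mem_univ, true_and] at hv ⊢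
    obtain ⟨i, hi, hiv, hci⟩ := hc v hv
    have h1 := hold i hi
    have h2 := hmem h1
    have h3 := hfL i
    simp only [padMem, ltB, hi, h1, decide_true, cond_true, hiv] at h3
    rw [hci]
    exact ⟨h2.2, h3⟩
  · simp only [mem_filter, mem_univ, true_and] at hu hv
    obtain ⟨i, hi, hiu, hci⟩ := hc u hu
    obtain ⟨j, hj, hjv, hcj⟩ := hc v hv
    refine hf (i := i) (j := j) ?_ (Fin.ext (hinj (hold i hi) (hold j hj) ?_))
    · simpa only [padAdj, ltB, hi, hj, decide_true, Bool.and_self, cond_true, hiu, hjv] using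
        (hG u v).2 huv
    · rw [← hci, ← hcj, heq]

end Pad

end RegularListColoring

/-! ### Correctness of the program and size of its output -/

namespace RegularListColoring

open Machine ListColoring Finset
open scoped Classical

/-- An instance as it is written on the input. -/
noncomputable def toRaw (I : RegularListColoring) : Raw :=
  (I.n, I.m, I.k, List.ofFn fun u => List.ofFn fun v => decide (I.G.Adj u v),
    List.ofFn fun v => List.ofFn fun c => decide (c ∈ I.L v), ())

/-- Running times proved for raw data transfer to instances because both are written as the same
datum. -/
theorem enc_toRaw (I : RegularListColoring) : Enc.enc I.toRaw = I.encode := by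
  simp only [Enc.enc, toRaw, encode, Data.ofList, List.map_ofFn, Function.comp_def]

theorem esize_le_of_forall {α : Type} [Enc α] {l : List α} {s : ℕ} (h : ∀ a ∈ l, esize a ≤ s) :
    esize l ≤ l.length * (s + 1) := by
  induction l with
  | nil => simp [esize_nil]
  | cons a l ih =>
    have h1 := ih fun b hb => h b (List.mem_cons_of_mem _ hb)
    have h2 := h a List.mem_cons_self
    rw [esize_cons, List.length_cons, add_mul, one_mul]
    omega

theorem esize_matrix_le {n m : ℕ} (g : Fin n → Fin m → Bool) :
    esize (List.ofFn fun u => List.ofFn (g u)) ≤ n * (2 * m + 1) := by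
  have h := esize_le_of_forall (l := List.ofFn fun u => List.ofFn (g u)) (s := 2 * m) (by
    intro r hr
    obtain ⟨u, rfl⟩ := (List.mem_ofFn' _ _).1 hr
    have := esize_le_of_forall (l := List.ofFn (g u)) (s := 1) (by
      intro b _
      cases b
      · exact Nat.zero_le _
      · exact le_rfl)
    rw [List.length_ofFn] at this
    dsimp only
    omega)
  rwa [List.length_ofFn] at h

theorem size_le (I : RegularListColoring) :
    problem.size I ≤ I.n + I.m + I.k + I.n * (2 * I.n + 1) + I.n * (2 * I.m + 1) + 5 := by
  have h1 := esize_matrix_le fun u v => decide (I.G.Adj u v)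
  have h2 := esize_matrix_le fun v c => decide (c ∈ I.L v)
  have h3 : problem.size I = esize I.toRaw := by
    rw [esize, enc_toRaw]
    rfl
  rw [h3, toRaw]
  simp only [esize_pair, esize_nat]
  have h4 : esize () = 0 := rfl
  omega

section Spec

variable (I : RegularListColoring)

theorem adj_toRaw {u v : ℕ} :
    I.toRaw.adj u v = true ↔ ∃ (hu : u < I.n) (hv : v < I.n), I.G.Adj ⟨u, hu⟩ ⟨v, hv⟩ := by
  by_cases hu : u < I.n
  · have h1 : I.toRaw.adj u v =
        (List.ofFn fun v => decide (I.G.Adj ⟨u, hu⟩ v)).getD v false := by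
      have := ofFn_getD (fun u => List.ofFn fun v => decide (I.G.Adj u v)) [] ⟨u, hu⟩
      dsimp only at this
      rw [Raw.adj, ← this]
      rfl
    rw [h1]
    by_cases hv : v < I.n
    · have := ofFn_getD (fun v => decide (I.G.Adj ⟨u, hu⟩ v)) false ⟨v, hv⟩
      dsimp only at this
      rw [this]
      simp [hu, hv]
    · rw [List.getD_eq_default _ _ (by simpa using hv)]
      simp [hv]
  · have : I.toRaw.adj u v = false := by
      have : I.toRaw.2.2.2.1.getD u [] = [] :=
        List.getD_eq_default _ _ (by simpa [toRaw] using hu)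
      rw [Raw.adj, this]
      rfl
    rw [this]
    simp [hu]

theorem adj_toRaw_fin (u v : Fin I.n) : I.toRaw.adj u v = true ↔ I.G.Adj u v := by
  simp [adj_toRaw]

theorem adj_comm_toRaw (u v : ℕ) : I.toRaw.adj u v = I.toRaw.adj v u := by
  rw [Bool.eq_iff_iff, adj_toRaw, adj_toRaw]
  exact ⟨fun ⟨hu, hv, h⟩ => ⟨hv, hu, h.symm⟩, fun ⟨hu, hv, h⟩ => ⟨hv, hu, h.symm⟩⟩

theorem adj_self_toRaw (u : ℕ) : I.toRaw.adj u u = false := by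
  rw [← Bool.not_eq_true, adj_toRaw]
  rintro ⟨_, _, h⟩
  exact I.G.irrefl h

theorem mem_toRaw (v : Fin I.n) (c : Fin I.m) : I.toRaw.mem v c = true ↔ c ∈ I.L v := by
  have h1 := ofFn_getD (fun v => List.ofFn fun c => decide (c ∈ I.L v)) [] v
  have h2 := ofFn_getD (fun c => decide (c ∈ I.L v)) false c
  have : I.toRaw.mem v c = decide (c ∈ I.L v) := by
    rw [← h2, ← h1]
    rfl
  simp [this]

theorem isLow_toRaw (c : Fin I.m) : I.toRaw.isLow c = true ↔ c ∈ lowColors I.L I.k := by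
  have : (toRaw I).1 = I.n := rfl
  have hk : (toRaw I).2.2.1 = I.k := rfl
  have h : countN I.n (fun v => I.toRaw.mem v c) = (vertsOf I.L c).card := by
    rw [countN_eq_card]
    congr 1
    ext v
    rw [vertsOf, mem_filter, mem_filter, mem_toRaw]
  rw [Raw.isLow, ltB_eq_true, this, hk, h, lowColors, mem_filter]
  simp

theorem isRich_toRaw (v : Fin I.n) : I.toRaw.isRich v = true ↔ v ∈ rich I.L I.k := by
  have : (toRaw I).2.1 = I.m := rfl
  have hk : (toRaw I).2.2.1 = I.k := rfl
  rw [Raw.isRich, this, hk, countN_eq_card]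
  simp only [Bool.and_eq_true, mem_toRaw, isLow_toRaw, Bool.not_eq_true', ltB,
    decide_eq_false_iff_not, not_lt]
  simp only [rich, mem_filter, mem_univ, true_and]
  have : I.L v ∩ lowColors I.L I.k =
      univ.filter fun c => c ∈ I.L v ∧ c ∈ lowColors I.L I.k := by
    ext c
    simp
  rw [this]

theorem isHeavy_toRaw (v : Fin I.n) : I.toRaw.isHeavy v = true ↔ v ∈ heavy I.G I.L I.k := by
  have : (toRaw I).1 = I.n := rfl
  have hk : (toRaw I).2.2.1 = I.k := rfl
  have h : countN I.n (fun u => !I.toRaw.isRich u && !I.toRaw.adj v u) =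
      (nonAdj I.G I.L I.k v).card := by
    rw [countN_eq_card]
    congr 1
    ext u
    rw [mem_nonAdj, mem_filter]
    simp only [Bool.and_eq_true, Bool.not_eq_true', ← Bool.not_eq_true, isRich_toRaw,
      adj_toRaw_fin, mem_univ, true_and]
  rw [Raw.isHeavy, this, hk, h, heavy, mem_filter]
  simp only [Bool.and_eq_true, Bool.not_eq_true', ← Bool.not_eq_true, isRich_toRaw, ltB_eq_true,
    not_lt, mem_univ, true_and]

theorem isLight_toRaw (v : Fin I.n) : I.toRaw.isLight v = true ↔ v ∈ light I.G I.L I.k := by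
  rw [Raw.isLight]
  simp only [Bool.and_eq_true, Bool.not_eq_true', ← Bool.not_eq_true, isRich_toRaw, isHeavy_toRaw]
  rw [mem_light]

theorem isPlain_toRaw (v : Fin I.n) : I.toRaw.isPlain v = true ↔ v ∈ plain I.G I.L I.k := by
  have hn : (toRaw I).1 = I.n := rfl
  have hm : (toRaw I).2.1 = I.m := rfl
  rw [Raw.isPlain, hn, hm]
  simp only [Bool.and_eq_true, Bool.not_eq_true', ← Bool.not_eq_true, anyN_eq_true, mem_toRaw,
    isLow_toRaw, isLight_toRaw, Bool.or_eq_true, ltB_eq_true, adj_toRaw_fin, mem_plain]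
  have hne : ∀ u : Fin I.n, ((u : ℕ) < v ∨ (v : ℕ) < u) ↔ u ≠ v := fun u => by
    rw [← lt_or_lt_iff_ne]; rfl
  simp only [hne, not_exists, not_and, not_not]
  tauto

theorem isKeptLow_toRaw (c : Fin I.m) : I.toRaw.isKeptLow c = true ↔ c ∈ keptLow I.L I.k := by
  have hn : (toRaw I).1 = I.n := rfl
  rw [Raw.isKeptLow, hn]
  simp only [Bool.and_eq_true, Bool.not_eq_true', ← Bool.not_eq_true, anyN_eq_true, mem_toRaw,
    isLow_toRaw, isRich_toRaw, mem_keptLow]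

theorem numHigh_toRaw : I.toRaw.numHigh = (highColors I.L I.k).card := by
  have hm : (toRaw I).2.1 = I.m := rfl
  rw [Raw.numHigh, hm, countN_eq_card]
  congr 1
  ext c
  simp only [mem_filter, mem_univ, true_and, Bool.not_eq_true', ← Bool.not_eq_true, isLow_toRaw,
    mem_highColors]

theorem numPlain_toRaw : I.toRaw.numPlain = (plain I.G I.L I.k).card := by
  have hn : (toRaw I).1 = I.n := rfl
  rw [Raw.numPlain, hn, countN_eq_card]
  congr 1
  ext v
  simp only [mem_filter, mem_univ, true_and, isPlain_toRaw]

theorem isBounded_toRaw : I.toRaw.isBounded = true ↔ Bounded I.G I.L I.k := by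
  have hn : (toRaw I).1 = I.n := rfl
  have hm : (toRaw I).2.1 = I.m := rfl
  have hk : (toRaw I).2.2.1 = I.k := rfl
  have h1 : countN I.m I.toRaw.isKeptLow = (keptLow I.L I.k).card := by
    rw [countN_eq_card]
    congr 1
    ext v
    simp only [mem_filter, mem_univ, true_and, isKeptLow_toRaw]
  rw [Raw.isBounded, hn, hm, hk, h1, numHigh_toRaw, numPlain_toRaw]
  simp only [Bool.and_eq_true, ltB_eq_true, Nat.lt_succ_iff, Bounded, card_compl, Fintype.card_fin,
    ← sq, and_assoc]

/-- The high colors that are kept. -/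
noncomputable def keptHigh : Finset (Fin I.m) := univ.filter fun c => I.toRaw.isKeptHigh c = true

/-- The plain vertices that are kept. -/
noncomputable def keptPlain : Finset (Fin I.n) := univ.filter fun v => I.toRaw.isKeptPlain v = true

theorem keptHigh_subset : I.keptHigh ⊆ highColors I.L I.k := by
  intro c hc
  simp only [keptHigh, Raw.isKeptHigh, mem_filter, Bool.and_eq_true, Bool.not_eq_true',
    ← Bool.not_eq_true, isLow_toRaw] at hc
  exact mem_highColors.2 hc.2.1

theorem keptPlain_subset : I.keptPlain ⊆ plain I.G I.L I.k := by
  intro c hc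
  simp only [keptPlain, Raw.isKeptPlain, mem_filter, Bool.and_eq_true, isPlain_toRaw] at hc
  exact hc.2.1

theorem quota_toRaw : I.toRaw.quota = min (highColors I.L I.k).card (120 * I.k ^ 2) := by
  rw [Raw.quota, numHigh_toRaw, sq]
  rfl

theorem card_keptHigh : I.keptHigh.card = min (highColors I.L I.k).card (120 * I.k ^ 2) := by
  have h := countN_first I.m I.toRaw.quota fun c => !I.toRaw.isLow c
  have h' : countN I.m (fun c => !I.toRaw.isLow c) = (highColors I.L I.k).card := I.numHigh_toRaw
  rw [keptHigh, ← countN_eq_card]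
  refine h.trans ?_
  rw [h', quota_toRaw]
  omega

theorem card_keptPlain : I.keptPlain.card =
    I.keptHigh.card + (plain I.G I.L I.k).card - (highColors I.L I.k).card := by
  have h := countN_first I.n (I.toRaw.quota + I.toRaw.numPlain - I.toRaw.numHigh) I.toRaw.isPlain
  have h' : countN I.n I.toRaw.isPlain = (plain I.G I.L I.k).card := I.numPlain_toRaw
  rw [keptPlain, ← countN_eq_card]
  refine h.trans ?_
  rw [h', numPlain_toRaw, numHigh_toRaw, card_keptHigh, quota_toRaw]
  omega

theorem isSmall_toRaw : I.toRaw.isSmall = true ↔ I.n < 30 * I.k := by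
  rw [Raw.isSmall, ltB_eq_true]
  rfl

/-- The vertices that are kept. -/
noncomputable def keptVerts : Finset (Fin I.n) := univ.filter fun v => I.toRaw.keepV v = true

/-- The colors that are kept. -/
noncomputable def keptColors : Finset (Fin I.m) := univ.filter fun c => I.toRaw.keepC c = true

/-- The lists before padding. -/
noncomputable def newList (v : Fin I.n) : Finset (Fin I.m) :=
  univ.filter fun c => I.toRaw.keepC c = true ∧ I.toRaw.newMem v c = true

theorem keptVerts_of_small (h : I.n < 30 * I.k) : I.keptVerts = univ := by
  have := I.isSmall_toRaw.2 h
  simp [keptVerts, Raw.keepV, this]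

theorem keptColors_of_small (h : I.n < 30 * I.k) : I.keptColors = univ.biUnion I.L := by
  have := I.isSmall_toRaw.2 h
  have hn : (toRaw I).1 = I.n := rfl
  ext c
  simp [keptColors, Raw.keepC, this, hn, anyN_eq_true, mem_toRaw]

theorem newList_of_small (h : I.n < 30 * I.k) : I.newList = I.L := by
  have := I.isSmall_toRaw.2 h
  have hn : (toRaw I).1 = I.n := rfl
  ext v c
  simp only [newList, Raw.keepC, this, hn, anyN_eq_true, mem_toRaw, Raw.newMem, mem_filter,
    mem_univ, true_and, cond_true, Bool.not_true, Bool.false_and, cond_false]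
  exact ⟨fun h => h.2, fun h => ⟨⟨v, h⟩, h⟩⟩

theorem keptVerts_of_bounded (h : ¬ I.n < 30 * I.k) (hb : Bounded I.G I.L I.k) :
    I.keptVerts = core I.G I.L I.k ∪ I.keptPlain := by
  have h1 : I.toRaw.isSmall = false := by
    rwa [← Bool.not_eq_true, isSmall_toRaw]
  have h2 := I.isBounded_toRaw.2 hb
  ext v
  simp only [keptVerts, Raw.keepV, h1, h2, cond_false, Bool.true_and, Bool.or_eq_true,
    Bool.and_eq_true, isLight_toRaw, Bool.not_eq_true', ← Bool.not_eq_true, isPlain_toRaw,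
    mem_filter, mem_univ, true_and, mem_union, mem_core, keptPlain]

theorem keptColors_of_bounded (h : ¬ I.n < 30 * I.k) (hb : Bounded I.G I.L I.k) :
    I.keptColors = keptLow I.L I.k ∪ I.keptHigh := by
  have h1 : I.toRaw.isSmall = false := by
    rwa [← Bool.not_eq_true, isSmall_toRaw]
  have h2 := I.isBounded_toRaw.2 hb
  ext v
  simp only [keptColors, Raw.keepC, h1, h2, cond_false, Bool.true_and, Bool.or_eq_true,
    isKeptLow_toRaw, mem_filter, mem_univ, true_and, mem_union, keptHigh]

theorem newList_of_bounded (h : ¬ I.n < 30 * I.k) (hb : Bounded I.G I.L I.k) :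
    I.newList = reducedList I.G I.L I.k I.keptHigh := by
  have h1 : I.toRaw.isSmall = false := by
    rwa [← Bool.not_eq_true, isSmall_toRaw]
  have h2 : ∀ c : Fin I.m, I.toRaw.keepC c = true ↔ c ∈ keptLow I.L I.k ∪ I.keptHigh := by
    intro c
    rw [← keptColors_of_bounded I h hb]
    simp [keptColors]
  have h3 : ∀ c : Fin I.m, I.toRaw.isKeptHigh c = true ↔ c ∈ I.keptHigh := by
    simp [keptHigh]
  ext v c
  by_cases hv : v ∈ plain I.G I.L I.k
  · have := (I.isPlain_toRaw v).2 hv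
    simp only [newList, reducedList, Raw.newMem, h1, this, hv, h2, h3, mem_filter, mem_univ,
      true_and, if_true, Bool.not_false, Bool.and_self, cond_true, mem_union]
    tauto
  · have : I.toRaw.isPlain v = false := by
      rwa [← Bool.not_eq_true, isPlain_toRaw]
    simp only [newList, reducedList, Raw.newMem, h1, this, hv, h2, mem_toRaw, mem_filter, mem_univ,
      true_and, if_false, Bool.not_false, Bool.and_false, cond_false, mem_inter]
    tauto

theorem keptVerts_of_not_bounded (h : ¬ I.n < 30 * I.k) (hb : ¬ Bounded I.G I.L I.k) :
    I.keptVerts = ∅ := by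
  have h1 : I.toRaw.isSmall = false := by
    rwa [← Bool.not_eq_true, isSmall_toRaw]
  have h2 : I.toRaw.isBounded = false := by
    rwa [← Bool.not_eq_true, isBounded_toRaw]
  simp [keptVerts, Raw.keepV, h1, h2]

theorem keptColors_of_not_bounded (h : ¬ I.n < 30 * I.k) (hb : ¬ Bounded I.G I.L I.k) :
    I.keptColors = ∅ := by
  have h1 : I.toRaw.isSmall = false := by
    rwa [← Bool.not_eq_true, isSmall_toRaw]
  have h2 : I.toRaw.isBounded = false := by
    rwa [← Bool.not_eq_true, isBounded_toRaw]
  simp [keptColors, Raw.keepC, h1, h2]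

theorem length_vs : I.toRaw.vs.length = I.keptVerts.card := countN_eq_card I.n I.toRaw.keepV

theorem length_cs : I.toRaw.cs.length = I.keptColors.card := countN_eq_card I.m I.toRaw.keepC

/-- Small instances have fewer than 30k vertices. Otherwise the core has at most 60k² vertices, and
|W₀| ≤ |Q₀| + (|plain| - |high|) ≤ 120k² + k. -/
theorem card_keptVerts_le : I.keptVerts.card ≤ 200 * I.k ^ 2 := by
  have hk : I.k ≤ I.k ^ 2 := Nat.le_self_pow two_ne_zero _
  by_cases h : I.n < 30 * I.k
  · rw [keptVerts_of_small I h, card_univ, Fintype.card_fin]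
    omega
  by_cases hb : Bounded I.G I.L I.k
  · rw [keptVerts_of_bounded I h hb]
    have h1 := card_union_le (core I.G I.L I.k) I.keptPlain
    have h2 : (core I.G I.L I.k).card ≤ (plain I.G I.L I.k)ᶜ.card :=
      card_le_card fun v hv => by simpa using (mem_core.1 hv).2
    have h3 := hb.2.1
    have h4 := I.card_keptPlain
    have h5 := I.card_keptHigh
    have h6 : (plain I.G I.L I.k).card ≤ (highColors I.L I.k).card + I.k := by
      rcases (plain I.G I.L I.k).eq_empty_or_nonempty with h | ⟨v, hv⟩
      · simp [h]
      · have e1 : I.L v ⊆ highColors I.L I.k := fun c hc =>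
          mem_highColors.2 ((mem_plain.1 hv).2.1 c hc)
        have e2 := card_le_card e1
        have e3 := I.card_add v
        have e4 := card_le_univ (plain I.G I.L I.k)
        rw [Fintype.card_fin] at e4
        omega
    omega
  · rw [keptVerts_of_not_bounded I h hb]
    simp

/-- The constant comes from small instances, where fewer than 30k lists have fewer than 30k colors
each; the other cases need only 126k². -/
theorem card_keptColors_le : I.keptColors.card ≤ 900 * I.k ^ 2 := by
  by_cases h : I.n < 30 * I.k
  · rw [keptColors_of_small I h]
    have h1 := card_biUnion_le_card_mul univ I.L I.n fun v _ => by
      have := I.card_add v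
      omega
    rw [card_univ, Fintype.card_fin] at h1
    have h2 : I.n * I.n ≤ (30 * I.k) * (30 * I.k) := by gcongr
    have h3 : (30 * I.k) * (30 * I.k) = 900 * I.k ^ 2 := by ring
    omega
  by_cases hb : Bounded I.G I.L I.k
  · rw [keptColors_of_bounded I h hb]
    have h1 := card_union_le (keptLow I.L I.k) I.keptHigh
    have h3 := hb.2.2
    have h5 := I.card_keptHigh
    omega
  · rw [keptColors_of_not_bounded I h hb]
    simp

/-- The kernel. -/
noncomputable def kernel : RegularListColoring :=
  pad I.toRaw.adj I.toRaw.newMem I.toRaw.vs I.toRaw.cs I.adj_comm_toRaw I.adj_self_toRaw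

theorem toRaw_kernel : I.kernel.toRaw = I.toRaw.kernel := by
  have h1 : ∀ u v, decide (I.kernel.G.Adj u v) = padAdj I.toRaw.adj I.toRaw.vs u v := fun u v => by
    rw [Bool.eq_iff_iff, decide_eq_true_iff]
    rfl
  have h2 : ∀ v c, decide (c ∈ I.kernel.L v) =
      padMem I.toRaw.newMem I.toRaw.vs I.toRaw.cs v c := fun v c => by
    rw [Bool.eq_iff_iff, decide_eq_true_iff]
    exact mem_filter.trans (and_iff_right (mem_univ _))
  rw [toRaw]
  simp only [h1, h2, Raw.kernel, tabulate_eq_ofFn]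
  rfl

theorem hasListColoring_iff : I.HasListColoring ↔ ∃ c, IsColoringOn I.G I.L univ c := by
  constructor
  · rintro ⟨c, hc⟩
    exact ⟨c, fun v _ => hc v, fun u _ v _ h => c.valid h⟩
  · rintro ⟨c, hc⟩
    exact ⟨⟨c, fun {u v} h => hc.2 u (mem_univ u) v (mem_univ v) h⟩, fun v => hc.1 v (mem_univ v)⟩

theorem kernel_hasListColoring {c : Fin I.n → Fin I.m}
    (hc : IsColoringOn I.G I.newList I.keptVerts c) : I.kernel.HasListColoring :=
  pad_hasListColoring I.adj_toRaw_fin hc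

theorem exists_coloring_of_kernel (d : Fin I.n → Fin I.m) (h : I.kernel.HasListColoring) :
    ∃ c, IsColoringOn I.G I.newList I.keptVerts c :=
  exists_coloring_of_pad I.adj_toRaw_fin d h

theorem nonempty_colors (h : ¬ I.n < 30 * I.k) (v : Fin I.n) : Nonempty (Fin I.m) := by
  have := I.card_add v
  have := v.2
  obtain ⟨c, _⟩ := card_pos.1 (show 0 < (I.L v).card by omega)
  exact ⟨c⟩

/-- A small instance is only padded. A bounded one is reduced, and the backward direction argues by
contradiction to obtain the Hall violator. Otherwise both sides hold: uncolorable graphs are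
bounded, and the empty instance is colorable. -/
theorem hasListColoring_iff_kernel : I.HasListColoring ↔ I.kernel.HasListColoring := by
  have hL : ∀ v, (I.L v).card + I.k = Fintype.card (Fin I.n) := by
    simpa using I.card_add
  rw [hasListColoring_iff]
  by_cases h : I.n < 30 * I.k
  · have h1 := I.keptVerts_of_small h
    have h2 := I.newList_of_small h
    constructor
    · rintro ⟨c, hc⟩
      exact I.kernel_hasListColoring (c := c) (by rwa [h1, h2])
    · intro hK
      -- A small instance may have no colors at all. If it has a vertex, the coloring of the padded
      -- instance shows that some color was kept.
      have : Nonempty (Fin I.n → Fin I.m) := by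
        rcases isEmpty_or_nonempty (Fin I.n) with hn | ⟨⟨v⟩⟩
        · exact ⟨hn.elim⟩
        · obtain ⟨c, _⟩ := hK
          have h3 : 0 < I.kernel.n := by
            have e1 : I.kernel.n = I.toRaw.vs.length + I.toRaw.cs.length := rfl
            have e2 := I.length_vs
            rw [h1, card_univ, Fintype.card_fin] at e2
            have := v.2
            omega
          have h4 := (c ⟨0, h3⟩).2
          have h5 : I.kernel.m = I.toRaw.cs.length + I.toRaw.cs.length := rfl
          have h6 := I.length_cs
          obtain ⟨x, _⟩ := card_pos.1 (show 0 < I.keptColors.card by omega)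
          exact ⟨fun _ => x⟩
      obtain ⟨d⟩ := this
      have := I.exists_coloring_of_kernel d hK
      rwa [h1, h2] at this
  by_cases hb : Bounded I.G I.L I.k
  · have h1 := I.keptVerts_of_bounded h hb
    have h2 := I.newList_of_bounded h hb
    have hn : 0 < I.n := by
      have := hb.1
      rw [Fintype.card_fin] at this
      omega
    have := I.nonempty_colors h ⟨0, hn⟩
    constructor
    · rintro ⟨c, hc⟩
      obtain ⟨c', hc'⟩ := exists_reduced_coloring hL hb.1 hb.2.1 I.keptHigh_subset
        I.keptPlain_subset I.card_keptHigh I.card_keptPlain hc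
      exact I.kernel_hasListColoring (c := c') (by rwa [h1, h2])
    · intro hK
      by_contra hno
      obtain ⟨c, hc⟩ := I.exists_coloring_of_kernel (fun _ => Classical.arbitrary _) hK
      rw [h1, h2] at hc
      exact (bounded_and_not_reduced hL (by simpa using h) hno).2 I.keptHigh I.keptPlain
        I.keptPlain_subset I.card_keptHigh I.card_keptPlain ⟨c, hc⟩
  · have h1 := I.keptVerts_of_not_bounded h hb
    constructor
    · rintro ⟨c, _⟩
      exact I.kernel_hasListColoring (c := c) (by rw [h1]; exact ⟨by simp, by simp⟩)
    · intro _
      by_contra hno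
      rcases isEmpty_or_nonempty (Fin I.n) with hn | ⟨⟨v⟩⟩
      · exact hno ⟨hn.elim, fun v => hn.elim v, fun v => hn.elim v⟩
      · have := I.nonempty_colors h v
        exact hb (bounded_and_not_reduced hL (by simpa using h) hno).1

end Spec

end RegularListColoring

/-! ### The kernel and its bounds -/

open Machine Polynomial in
theorem RegularListColoring.isPolynomialKernel_kernel :
    RegularListColoring.problem.IsPolynomialKernel RegularListColoring.kernel := by
  refine ⟨⟨?_, fun I => I.hasListColoring_iff_kernel⟩, ?_⟩
  · obtain ⟨c, p, h⟩ := RegularListColoring.Raw.pt_kernel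
    refine ⟨c, p, fun (I : RegularListColoring) => ?_⟩
    have := h I.toRaw
    rwa [← RegularListColoring.toRaw_kernel, RegularListColoring.enc_toRaw,
      RegularListColoring.enc_toRaw] at this
  -- With at most 200k² vertices and 900k² colors before padding, 1800k² bounds all three numbers of
  -- the output: at most 1100k² vertices, 1800k² colors and parameter 200k².
  · refine ⟨3 * (1800 * X ^ 2) + (1800 * X ^ 2) * (2 * (1800 * X ^ 2) + 1) +
      (1800 * X ^ 2) * (2 * (1800 * X ^ 2) + 1) + 5 + 1800 * X ^ 2, fun (I : RegularListColoring) => ?_⟩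
    have h1 := I.kernel.size_le
    have h2 := I.card_keptVerts_le
    have h3 := I.card_keptColors_le
    rw [← RegularListColoring.length_vs] at h2
    rw [← RegularListColoring.length_cs] at h3
    have hn : I.kernel.n ≤ 1800 * I.k ^ 2 :=
      show I.toRaw.vs.length + I.toRaw.cs.length ≤ _ by omega
    have hm : I.kernel.m ≤ 1800 * I.k ^ 2 :=
      show I.toRaw.cs.length + I.toRaw.cs.length ≤ _ by omega
    have hk : I.kernel.k ≤ 1800 * I.k ^ 2 := show I.toRaw.vs.length ≤ _ by omega
    have h4 : I.kernel.n * (2 * I.kernel.n + 1) ≤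
        (1800 * I.k ^ 2) * (2 * (1800 * I.k ^ 2) + 1) := by gcongr
    have h5 : I.kernel.n * (2 * I.kernel.m + 1) ≤
        (1800 * I.k ^ 2) * (2 * (1800 * I.k ^ 2) + 1) := by gcongr
    have h6 : RegularListColoring.problem.param I = I.k := rfl
    have h7 : RegularListColoring.problem.param I.kernel = I.kernel.k := rfl
    rw [h6, h7]
    simp only [eval_add, eval_mul, eval_pow, eval_X, eval_ofNat, eval_one]
    omega

theorem mainTheorem3 :
    ∃ κ : RegularListColoring → RegularListColoring,
      RegularListColoring.problem.IsPolynomialKernel κ ∧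
      ∃ C : ℕ, ∀ I : RegularListColoring,
        (κ I).n ≤ C * I.k ^ 2 ∧ (κ I).m ≤ C * I.k ^ 2 := by
  refine ⟨_, RegularListColoring.isPolynomialKernel_kernel, 1800, fun (I : RegularListColoring) => ?_⟩
  have h2 := I.card_keptVerts_le
  have h3 := I.card_keptColors_le
  rw [← RegularListColoring.length_vs] at h2
  rw [← RegularListColoring.length_cs] at h3
  exact ⟨show I.toRaw.vs.length + I.toRaw.cs.length ≤ _ by omega,
    show I.toRaw.cs.length + I.toRaw.cs.length ≤ _ by omega⟩
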